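/- A configuration of $n$ modules is a set $C$ of $n$ cells of the square grid $\mathbb Z^2$ whose facet-adjacency graph (cells sharing an edge) is connected; configurations are considered up to translation. Write $S=C\setminus\{a\}$ for the modules other than a moving module $a$. Let $d,e$ be perpendicular unit axis vectors. A quarter turn moves $a$ from a cell $p$ to $p+d$ by a $90^\circ$ rotation about the vertex shared by $p,\ p+d,\ p+e,\ p+d+e$; it is possible if the cells $p+d,\ p-e,\ p+d-e$ are not in $S$ and at least one of $p+e,\ p+d+e$ is in $S$. The three nested sets of pivot moves are as follows. 1. Restrictive: $p+e\in S$, and $a$ makes the quarter turn from $p$ to $p+d$ if $p+d+e\in S$, or, if $p+d+e\notin S$, a $180^\circ$ rotation from $p$ to $p+d+e$ consisting of two successive possible quarter turns (via $p+d$) about the same vertex. 2. Leapfrog: additionally, every possible quarter turn such that $a$ is facet-adjacent to some module of $S$ both before and after it. 3. Monkey: additionally, every concatenation of two possible quarter turns such that $a$ is facet-adjacent to some module of $S$ before the first and after the second, but to none in between. In every move $S$ has to be facet-connected. For a set of moves, the reconfiguration graph $\mathcal G_n$ has the configurations of $n$ modules as nodes, and an edge between two distinct configurations if one is obtained from the other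 by one move. Up to rotation and reflection, pattern I consists of three consecutive cells in a line, the middle one empty and the outer two occupied; pattern Z consists of the four cells of a Z-tetromino, the middle two empty and the end two occupied. (The third pattern usually forbidden together with these, the corner bottleneck $\Gamma$, in which two modules meet only at a vertex whose other two cells are empty, is allowed here.) Call a configuration *$\Gamma$-only* if it contains neither pattern I nor pattern Z. **Proposition.** There are a real number $c>1$ and an integer $N$ such that for every $n\ge N$ and for each of the three sets of pivot moves: (a) at least $c^n$ connected components of $\mathcal G_n$ are singletons consisting of a $\Gamma$-only configuration; (b) at least $c^n$ connected components of $\mathcal G_n$ contain at least $c^n$ $\Gamma$-only configurations each (and so have exponential size); (c) the same holds for the subgraph $\mathcal G_n[\Gamma]$ of $\mathcal G_n$ induced by the $\Gamma$-only configurations: at least $c^n$ of its connected components are singletons, and at least $c^n$ of its connected components have at least $c^n$ nodes each. -/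

import Mathlib

/-- A cell of the square grid, i.e. a unit square indexed by its integer coordinates. -/
abbrev Cell : Type := ℤ × ℤ

/-- The square grid: two cells are adjacent when they share an edge (facet-adjacency). -/
def gridGraph : SimpleGraph Cell where
  Adj p q := |p.1 - q.1| + |p.2 - q.2| = 1
  symm := ⟨fun p q h => by rw [abs_sub_comm q.1, abs_sub_comm q.2]; exact h⟩
  loopless := ⟨fun p h => by simp at h⟩

/-- A finite set of cells is facet-connected when its facet-adjacency graph is connected
(in particular it is nonempty). -/
def FacetConnected (C : Finset Cell) : Prop :=
  (gridGraph.induce (C : Set Cell)).Connected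

/-- `p` is facet-adjacent to some module of `S`. -/
def Touches (S : Finset Cell) (p : Cell) : Prop :=
  ∃ s ∈ S, gridGraph.Adj p s

/-- The four axis directions. -/
def IsDir (d : Cell) : Prop :=
  d = (1, 0) ∨ d = (-1, 0) ∨ d = (0, 1) ∨ d = (0, -1)

/-- Two perpendicular axis directions. -/
def PerpDirs (d e : Cell) : Prop :=
  IsDir d ∧ IsDir e ∧ d.1 * e.1 + d.2 * e.2 = 0

/-! ### Pivot moves

`S` is always the set of static modules, that is, all modules except the moving one. -/

/-- A collision-free quarter turn of a module from cell `p` to cell `p + d`, about the lattice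
vertex common to the four cells `p`, `p + d`, `p + e`, `p + d + e`.  The cells whose interior is
met by the rotating square are `p`, `p + d`, `p - e`, `p + d - e`.  The turn is about a vertex of
a static module, which occupies `p + e` or `p + d + e`. -/
structure QuarterTurn (S : Finset Cell) (p d e : Cell) : Prop where
  perp : PerpDirs d e
  goal_clear : p + d ∉ S
  clear_start : p - e ∉ S
  clear_goal : p + d - e ∉ S
  support : p + e ∈ S ∨ p + d + e ∈ S

/-- Set 1.  The module at `p` is facet-adjacent to a static module `s = p + e`, and turns about an
endpoint of their common edge: by 90 degrees if the neighbour `s' = p + d + e` of `s` is present,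
and by 180 degrees (two quarter turns about the same vertex) if it is not. -/
def RestrictiveMove (S : Finset Cell) (p q : Cell) : Prop :=
  ∃ d e : Cell, QuarterTurn S p d e ∧ p + e ∈ S ∧
    ((p + d + e ∈ S ∧ q = p + d) ∨
      (p + d + e ∉ S ∧ QuarterTurn S (p + d) e (-d) ∧ q = p + d + e))

/-- Set 2.  Additionally, any quarter turn such that the moving module is facet-adjacent to some
module before the turn and to some module after it. -/
def LeapfrogMove (S : Finset Cell) (p q : Cell) : Prop :=
  RestrictiveMove S p q ∨
    ∃ d e : Cell, QuarterTurn S p d e ∧ q = p + d ∧ Touches S p ∧ Touches S q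

/-- Set 3.  Additionally, the concatenation of two quarter turns between which the moving module
is facet-adjacent to no module, being facet-adjacent to some module at the start and at the end.
(More than two quarter turns are never needed to become facet-adjacent again.) -/
def MonkeyMove (S : Finset Cell) (p q : Cell) : Prop :=
  LeapfrogMove S p q ∨
    ∃ d e d' e' : Cell, QuarterTurn S p d e ∧ QuarterTurn S (p + d) d' e' ∧ q = p + d + d' ∧
      Touches S p ∧ ¬ Touches S (p + d) ∧ Touches S q

/-- The three sets of pivot moves. -/
inductive MoveSet : Type
  | restrictive
  | leapfrog
  | monkey

/-- `M.Move S p q`: in presence of the static modules `S`, a module can go from `p` to `q` by one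
move of the set `M`. -/
def MoveSet.Move : MoveSet → Finset Cell → Cell → Cell → Prop
  | .restrictive => RestrictiveMove
  | .leapfrog => LeapfrogMove
  | .monkey => MonkeyMove

/-- `C'` is obtained from `C` by one pivot move of the set `M`, the other modules staying
facet-connected. -/
def PivotStep (M : MoveSet) (C C' : Finset Cell) : Prop :=
  ∃ p ∈ C, ∃ q : Cell,
    FacetConnected (C.erase p) ∧ M.Move (C.erase p) p q ∧ C' = insert q (C.erase p)

/-! ### Forbidden patterns (in all orientations) -/

/-- Pattern I: module, empty cell, module, consecutive along a line. -/
def HasPatternI (C : Finset Cell) : Prop :=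
  ∃ p d : Cell, IsDir d ∧ p ∈ C ∧ p + d ∉ C ∧ p + d + d ∈ C

/-- Pattern Z: module, empty cell, empty cell, module, consecutive along a Z-tetromino. -/
def HasPatternZ (C : Finset Cell) : Prop :=
  ∃ p d e : Cell, PerpDirs d e ∧
    p ∈ C ∧ p + d ∉ C ∧ p + d + e ∉ C ∧ p + d + e + d ∈ C

/-! ### The reconfiguration graph -/

/-- Facet-connected configurations of `n` modules, placed in the grid. -/
def Configuration (n : ℕ) : Type :=
  {C : Finset Cell // C.card = n ∧ FacetConnected C}

/-- Two placed configurations are identified when they are translates of each other. -/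
instance translationSetoid (n : ℕ) : Setoid (Configuration n) where
  r C D := ∃ v : Cell, ∀ p : Cell, p ∈ C.1 ↔ p + v ∈ D.1
  iseqv :=
    { refl := fun _ => ⟨0, fun p => by simp⟩
      symm := by
        rintro C D ⟨v, h⟩
        exact ⟨-v, fun p => by rw [h (p + -v)]; simp⟩
      trans := by
        rintro C D F ⟨v, h⟩ ⟨w, k⟩
        exact ⟨v + w, fun p => by rw [h p, k (p + v), add_assoc]⟩ }

/-- Facet-connected configurations of `n` modules, up to translation. -/
def Shape (n : ℕ) : Type := Quotient (translationSetoid n)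

/-- The shape contains neither pattern I nor pattern Z.  (This does not depend on the placement.) -/
def Shape.OnlyGamma {n : ℕ} (X : Shape n) : Prop :=
  ∃ C : Configuration n, (Quotient.mk (translationSetoid n) C : Shape n) = X ∧
    ¬ HasPatternI C.1 ∧ ¬ HasPatternZ C.1

/-- The reconfiguration graph for the set `M` of pivot moves: two distinct configurations are
joined when one is obtained from the other by a single pivot move. -/
def reconfGraph (M : MoveSet) (n : ℕ) : SimpleGraph (Shape n) :=
  SimpleGraph.fromRel fun X Y => ∃ C D : Configuration n,
    (Quotient.mk (translationSetoid n) C : Shape n) = X ∧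
      (Quotient.mk (translationSetoid n) D : Shape n) = Y ∧ PivotStep M C.1 D.1

theorem gridGraph_walk_bound {C : Finset Cell} {a b : (C : Set Cell)}
    (w : (gridGraph.induce (C : Set Cell)).Walk a b) :
    |b.1.1 - a.1.1| ≤ w.length ∧ |b.1.2 - a.1.2| ≤ w.length := by
  induction w with
  | nil => simp
  | @cons u v x h w ih =>
    have h' : |u.1.1 - v.1.1| + |u.1.2 - v.1.2| = 1 := h
    have h1 := abs_le.1 ih.1
    have h2 := abs_le.1 ih.2
    have a1 := abs_nonneg (u.1.1 - v.1.1)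
    have a2 := abs_nonneg (u.1.2 - v.1.2)
    have b1 := abs_le.1 (show |u.1.1 - v.1.1| ≤ 1 by omega)
    have b2 := abs_le.1 (show |u.1.2 - v.1.2| ≤ 1 by omega)
    simp only [SimpleGraph.Walk.length_cons, Nat.cast_add, Nat.cast_one]
    constructor <;> rw [abs_le] <;> constructor <;> omega

/-- There are finitely many configurations of `n` modules up to translation, so that the
cardinalities `Set.ncard` of sets of shapes and of sets of components are the true ones. -/
instance Shape.instFinite (n : ℕ) : Finite (Shape n) := by
  classical
  let box : Finset Cell := Finset.Icc (-(n : ℤ)) n ×ˢ Finset.Icc (-(n : ℤ)) n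
  let T := {C : Configuration n // C.1 ⊆ box}
  have hT : Finite T := by
    refine Finite.of_injective
      (fun C : T => (⟨C.1.1, Finset.mem_powerset.2 C.2⟩ : box.powerset)) ?_
    intro C D h
    exact Subtype.ext (Subtype.ext (congrArg (fun x : box.powerset => x.1) h))
  refine Finite.of_surjective
    (fun C : T => (Quotient.mk (translationSetoid n) C.1 : Shape n)) ?_
  intro X
  refine Quotient.inductionOn X fun C => ?_
  obtain ⟨a⟩ := C.2.2.nonempty
  let f : Cell ↪ Cell := addRightEmbedding (-a.1)
  let e : gridGraph.induce (C.1 : Set Cell) ≃g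
      gridGraph.induce ((C.1.map f : Finset Cell) : Set Cell) :=
    { toFun := fun p => ⟨p.1 + -a.1, by
        simp [f]⟩
      invFun := fun p => ⟨p.1 + a.1, by
        obtain ⟨p, hp⟩ := p
        obtain ⟨r, hr, rfl⟩ := Finset.mem_map.1 (Finset.mem_coe.1 hp)
        simpa [f] using hr⟩
      left_inv := fun p => by simp
      right_inv := fun p => by simp
      map_rel_iff' := by
        intro p q
        simp [gridGraph] }
  have hconn : FacetConnected (C.1.map f) := e.connected_iff.1 C.2.2
  have hsub : C.1.map f ⊆ box := by
    intro p hp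
    obtain ⟨r, hr, rfl⟩ := Finset.mem_map.1 hp
    obtain ⟨w, hw⟩ := C.2.2.exists_isPath a ⟨r, hr⟩
    have hlen : w.length < n := by
      have := hw.length_lt
      simpa [C.2.1] using this
    have hb := gridGraph_walk_bound w
    have h1 := abs_le.1 hb.1
    have h2 := abs_le.1 hb.2
    simp only [] at h1 h2
    simp only [box, f, Finset.mem_product, Finset.mem_Icc, addRightEmbedding_apply,
      Prod.fst_add, Prod.snd_add, Prod.fst_neg, Prod.snd_neg]
    omega
  refine ⟨⟨⟨C.1.map f, by rw [Finset.card_map]; exact C.2.1, hconn⟩, hsub⟩, ?_⟩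
  refine Quotient.sound ⟨a.1, fun p => ?_⟩
  constructor
  · intro hp
    obtain ⟨r, hr, rfl⟩ := Finset.mem_map.1 hp
    simpa [f] using hr
  · intro hp
    exact Finset.mem_map.2 ⟨p + a.1, hp, by simp [f]⟩

/-! ### Facet-connectedness -/

/-! A module cannot move if it is a cut cell, since the others must stay connected, or if it is
jammed, since a quarter turn sweeps a fixed set of cells. Two kinds of jam are used: a module
between two opposite modules (`not_quarterTurn_of_opposite`), and a corner module facing another
module across its outer vertex (`not_quarterTurn_of_corner`). The second kind is available because
the bottleneck Γ is allowed.

The inner modules of a path are cut cells, so only its ends are a problem. Each end is therefore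
thickened to a 2×5 block. The sides of the block are jammed between opposite modules, and the path
winds around it so that its own corners face the free corners of the block. Elsewhere, gaps two
cells wide avoid the patterns I and Z. Such a path is rigid. Inserting bumps of two kinds, equal in
size and width, gives exponentially many rigid configurations.

For large components, the path also carries 8×5 rings jammed in the same way, each with one loose
module that slides along the inside and cannot escape. Let F be the set of modules other than the
loose ones and A the union of F with the interiors of the rings. No module of F can move in any
configuration between F and A, and the loose modules stay in A (`Enclosure`, `Capped.enclosure`), so
the shapes having a placement between F and A form a union of components. Bumps belong to F and so
separate components; two positions in each ring give exponentially many Γ-only members, joined by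
restrictive moves through Γ-only configurations.

All of this is local. The tiles are joined through single cells in row `1`, so finite checks of each
tile glue to statements about words of any length. Links, one cell each, adjust the size to any
large `n`. -/

theorem gridGraph_adj_iff {p q : Cell} :
    gridGraph.Adj p q ↔ |p.1 - q.1| + |p.2 - q.2| = 1 := Iff.rfl

/-- A colouring that is constant along adjacencies and takes two values shows that a finite set of
cells is not facet-connected. -/
theorem not_facetConnected_of_colouring {S : Finset Cell} (κ : Cell → Prop)
    (hκ : ∀ p ∈ S, ∀ q ∈ S, gridGraph.Adj p q → (κ p ↔ κ q))
    {a b : Cell} (ha : a ∈ S) (hb : b ∈ S) (hka : κ a) (hkb : ¬ κ b) : ¬ FacetConnected S := by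
  intro h
  obtain ⟨w⟩ := h.preconnected ⟨a, ha⟩ ⟨b, hb⟩
  have key : ∀ {x y : (S : Set Cell)}, (gridGraph.induce (S : Set Cell)).Walk x y →
      (κ x.1 ↔ κ y.1) := by
    intro x y w
    induction w with
    | nil => exact Iff.rfl
    | @cons u v z h w ih => exact (hκ u.1 u.2 v.1 v.2 h).trans ih
  exact hkb ((key w).1 hka)

/-- Facet-adjacency within a set of cells. -/
def AdjIn (S : Finset Cell) (p q : Cell) : Prop := p ∈ S ∧ q ∈ S ∧ gridGraph.Adj p q

/-- Reachability is phrased with cells of the grid, not with the subtype, so that it can be carried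
along by `flood_induction`. -/
theorem facetConnected_of_reach {S : Finset Cell} {r : Cell} (hr : r ∈ S)
    (h : ∀ p ∈ S, Relation.ReflTransGen (AdjIn S) r p) : FacetConnected S := by
  have key : ∀ p, Relation.ReflTransGen (AdjIn S) r p → ∀ hp : p ∈ S,
      (gridGraph.induce (S : Set Cell)).Reachable ⟨r, hr⟩ ⟨p, hp⟩ := by
    intro p hp
    induction hp with
    | refl => intro _; exact SimpleGraph.Reachable.refl _
    | @tail b c _ hbc ih =>
      intro hc
      refine (ih hbc.1).trans (SimpleGraph.Adj.reachable ?_)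
      exact hbc.2.2
  refine (SimpleGraph.connected_iff_exists_forall_reachable _).2 ⟨⟨r, hr⟩, ?_⟩
  rintro ⟨p, hp⟩
  exact key p (h p hp) hp

/-! ### Directions and quarter turns -/

theorem IsDir.neg {d : Cell} (h : IsDir d) : IsDir (-d) := by
  rcases h with rfl | rfl | rfl | rfl <;> simp [IsDir]

theorem PerpDirs.neg_left {d e : Cell} (h : PerpDirs d e) : PerpDirs (-d) e :=
  ⟨h.1.neg, h.2.1, by have := h.2.2; simp only [Prod.fst_neg, Prod.snd_neg]; linarith⟩

/-- The pivot is the same vertex; the two outer cells swept, and the two possible supports, trade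
places. -/
theorem QuarterTurn.reverse {S : Finset Cell} {p d e : Cell} (h : QuarterTurn S p d e)
    (hp : p ∉ S) : QuarterTurn S (p + d) (-d) e where
  perp := h.perp.neg_left
  goal_clear := by simpa using hp
  clear_start := h.clear_goal
  clear_goal := by simpa using h.clear_start
  support := by simpa using h.support.symm

/-- A cell between two opposite modules cannot turn. -/
theorem not_quarterTurn_of_opposite {S : Finset Cell} {p u d e : Cell} (hu : IsDir u)
    (h1 : p + u ∈ S) (h2 : p - u ∈ S) : ¬ QuarterTurn S p d e := by
  rintro ⟨⟨hd, he, hde⟩, hg, hs, -, -⟩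
  rcases hu with rfl | rfl | rfl | rfl <;> rcases hd with rfl | rfl | rfl | rfl <;>
    rcases he with rfl | rfl | rfl | rfl <;> simp_all [sub_eq_add_neg]

/-- A corner cell facing a module across its outer vertex cannot turn. -/
theorem not_quarterTurn_of_corner {S : Finset Cell} {p u v d e : Cell} (huv : PerpDirs u v)
    (h1 : p + u ∈ S) (h2 : p + v ∈ S) (h3 : p - u - v ∈ S) : ¬ QuarterTurn S p d e := by
  rintro ⟨⟨hd, he, hde⟩, hg, hs, hc, -⟩
  obtain ⟨hu, hv, huv⟩ := huv
  rcases hu with rfl | rfl | rfl | rfl <;> rcases hv with rfl | rfl | rfl | rfl <;>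
    first
    | (exfalso; revert huv; norm_num; done)
    | (rcases hd with rfl | rfl | rfl | rfl <;>
        rcases he with rfl | rfl | rfl | rfl <;>
        simp_all [sub_eq_add_neg, add_assoc])

/-! ### Reversibility of moves, and their decomposition into quarter turns -/

theorem RestrictiveMove.reverse {S : Finset Cell} {p q : Cell} (h : RestrictiveMove S p q)
    (hp : p ∉ S) : RestrictiveMove S q p := by
  obtain ⟨d, e, h1, hs, ⟨hs', rfl⟩ | ⟨hs', h2, rfl⟩⟩ := h
  · exact ⟨-d, e, h1.reverse hp, hs', Or.inl ⟨by simpa using hs, by simp⟩⟩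
  · have h1' := h1.reverse hp
    have h2' := h2.reverse h1.goal_clear
    have e1 : p + d + e + -e = p + d := by abel
    have e2 : p + d + e + -d = p + e := by abel
    have e3 : p + d + e + -e + -d = p := by abel
    -- The reversed half turn leaves along `-e` and is supported on the side `-d`, where the same
    -- static module lies.
    refine ⟨-e, -d, h2', by rw [e2]; exact hs, Or.inr ⟨by rw [e3]; exact hp, ?_, e3.symm⟩⟩
    rw [e1, neg_neg]
    exact h1'

theorem QuarterTurn.touches_reverse {S : Finset Cell} {p q : Cell} (hp : p ∉ S)
    (h : ∃ d e : Cell, QuarterTurn S p d e ∧ q = p + d ∧ Touches S p ∧ Touches S q) :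
    ∃ d e : Cell, QuarterTurn S q d e ∧ p = q + d ∧ Touches S q ∧ Touches S p := by
  obtain ⟨d, e, h1, rfl, h2, h3⟩ := h
  exact ⟨-d, e, h1.reverse hp, by simp, h3, h2⟩

theorem LeapfrogMove.reverse {S : Finset Cell} {p q : Cell} (h : LeapfrogMove S p q)
    (hp : p ∉ S) : LeapfrogMove S q p :=
  h.imp (fun h => h.reverse hp) (QuarterTurn.touches_reverse hp)

theorem MonkeyMove.reverse {S : Finset Cell} {p q : Cell} (h : MonkeyMove S p q)
    (hp : p ∉ S) : MonkeyMove S q p := by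
  refine h.imp (fun h => h.reverse hp) ?_
  rintro ⟨d, e, d', e', h1, h2, rfl, t1, t2, t3⟩
  have e1 : p + d + d' + -d' = p + d := by abel
  refine ⟨-d', e', -d, e, h2.reverse h1.goal_clear, ?_, ?_, t3, ?_, t1⟩
  · rw [e1]; exact h1.reverse hp
  · abel
  · rw [e1]; exact t2

theorem MoveSet.Move.reverse {M : MoveSet} {S : Finset Cell} {p q : Cell} (h : M.Move S p q)
    (hp : p ∉ S) : M.Move S q p := by
  cases M
  · exact RestrictiveMove.reverse h hp
  · exact LeapfrogMove.reverse h hp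
  · exact MonkeyMove.reverse h hp

/-- The three sets are nested: positive results need only restrictive moves. -/
theorem RestrictiveMove.move {S : Finset Cell} {p q : Cell} (h : RestrictiveMove S p q)
    (M : MoveSet) : M.Move S p q := by
  cases M
  · exact h
  · exact Or.inl h
  · exact Or.inl (Or.inl h)

/-- Every move is one quarter turn, or two successive ones. -/
theorem MoveSet.Move.turns {M : MoveSet} {S : Finset Cell} {p q : Cell} (h : M.Move S p q) :
    ∃ d e : Cell, QuarterTurn S p d e ∧
      (q = p + d ∨ ∃ d' e' : Cell, QuarterTurn S (p + d) d' e' ∧ q = p + d + d') := by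
  have hR : RestrictiveMove S p q → ∃ d e : Cell, QuarterTurn S p d e ∧
      (q = p + d ∨ ∃ d' e' : Cell, QuarterTurn S (p + d) d' e' ∧ q = p + d + d') := by
    rintro ⟨d, e, h1, -, ⟨-, rfl⟩ | ⟨-, h2, rfl⟩⟩
    · exact ⟨d, e, h1, Or.inl rfl⟩
    · exact ⟨d, e, h1, Or.inr ⟨e, -d, h2, rfl⟩⟩
  have hL : LeapfrogMove S p q → ∃ d e : Cell, QuarterTurn S p d e ∧
      (q = p + d ∨ ∃ d' e' : Cell, QuarterTurn S (p + d) d' e' ∧ q = p + d + d') := by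
    rintro (h | ⟨d, e, h1, rfl, -⟩)
    · exact hR h
    · exact ⟨d, e, h1, Or.inl rfl⟩
  cases M
  · exact hR h
  · exact hL h
  · rcases h with h | ⟨d, e, d', e', h1, h2, rfl, -⟩
    · exact hL h
    · exact ⟨d, e, h1, Or.inr ⟨d', e', h2, rfl⟩⟩

theorem MoveSet.Move.goal_notMem {M : MoveSet} {S : Finset Cell} {p q : Cell}
    (h : M.Move S p q) : q ∉ S := by
  obtain ⟨d, e, h1, rfl | ⟨d', e', h2, rfl⟩⟩ := h.turns
  · exact h1.goal_clear
  · exact h2.goal_clear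

/-- The edges of `reconfGraph` are symmetrised; with this, invariants need be checked in one
direction only. -/
theorem PivotStep.reverse {M : MoveSet} {C C' : Finset Cell} (h : PivotStep M C C') :
    PivotStep M C' C := by
  obtain ⟨p, hp, q, hc, hm, rfl⟩ := h
  have hq := hm.goal_notMem
  refine ⟨q, Finset.mem_insert_self _ _, p, ?_, ?_, ?_⟩ <;> rw [Finset.erase_insert hq]
  · exact hc
  · exact hm.reverse (Finset.notMem_erase _ _)
  · exact (Finset.insert_erase hp).symm

/-! ### Enclosures -/

/-- The cells of `F` are frozen and the other cells of `A` are enclosed by them: whatever cells of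
`A` are added to `F`, no module of `F` can move and no module can leave `A`. -/
structure Enclosure (F A : Finset Cell) : Prop where
  frozen : ∀ p ∈ F, ∀ C : Finset Cell, F ⊆ C → C ⊆ A → FacetConnected (C.erase p) →
    ∀ d e : Cell, ¬ QuarterTurn (C.erase p) p d e
  enclosed : ∀ p ∈ A, p ∉ F → ∀ d, IsDir d → p + d ∈ A

/-- The moving module is not frozen, so one quarter turn keeps it in `A`. It lands on an empty cell,
hence outside `F`, and the argument applies again to a second quarter turn. -/
theorem Enclosure.pivotStep {F A : Finset Cell} (h : Enclosure F A) {M : MoveSet}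
    {C C' : Finset Cell} (hFC : F ⊆ C) (hCA : C ⊆ A) (hs : PivotStep M C C') :
    F ⊆ C' ∧ C' ⊆ A := by
  obtain ⟨p, hp, q, hc, hm, rfl⟩ := hs
  obtain ⟨d, e, h1, h2⟩ := hm.turns
  have hpF : p ∉ F := fun hpF => h.frozen p hpF C hFC hCA hc d e h1
  have hFS : F ⊆ C.erase p := fun x hx =>
    Finset.mem_erase.2 ⟨fun hxp => hpF (hxp ▸ hx), hFC hx⟩
  have h3 : p + d ∈ A := h.enclosed p (hCA hp) hpF d h1.perp.1
  refine ⟨hFS.trans (Finset.subset_insert _ _), ?_⟩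
  refine Finset.insert_subset ?_ ((Finset.erase_subset _ _).trans hCA)
  rcases h2 with rfl | ⟨d', e', h2, rfl⟩
  · exact h3
  · exact h.enclosed _ h3 (fun hF => h1.goal_clear (hFS hF)) d' h2.perp.1

/-! ### Translations -/

/-- The translate of a set of cells. -/
def shiftCells (v : Cell) (S : Finset Cell) : Finset Cell := S.map (addRightEmbedding v)

@[simp] theorem mem_shiftCells {v p : Cell} {S : Finset Cell} :
    p ∈ shiftCells v S ↔ p - v ∈ S := by
  simp only [shiftCells, Finset.mem_map, addRightEmbedding_apply]
  constructor
  · rintro ⟨a, ha, rfl⟩; simpa using ha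
  · intro h; exact ⟨p - v, h, by simp⟩

theorem FacetConnected.translate {S : Finset Cell} (h : FacetConnected S) (v : Cell) :
    FacetConnected (shiftCells v S) := by
  let e : gridGraph.induce (S : Set Cell) ≃g
      gridGraph.induce ((shiftCells v S : Finset Cell) : Set Cell) :=
    { toFun := fun p => ⟨p.1 + v, by simp⟩
      invFun := fun p => ⟨p.1 - v, mem_shiftCells.1 (Finset.mem_coe.1 p.2)⟩
      left_inv := fun p => by simp
      right_inv := fun p => by simp
      map_rel_iff' := by intro p q; simp [gridGraph] }
  exact e.connected_iff.1 h

theorem QuarterTurn.translate {S : Finset Cell} {p d e : Cell} (h : QuarterTurn S p d e)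
    (v : Cell) : QuarterTurn (shiftCells v S) (p + v) d e := by
  have key : ∀ x, p + v + x - v = p + x := fun x => by abel
  have key2 : ∀ x y, p + v + x + y - v = p + x + y := fun x y => by abel
  refine ⟨h.perp, ?_, ?_, ?_, ?_⟩
  · rw [mem_shiftCells, key]; exact h.goal_clear
  · rw [mem_shiftCells, sub_eq_add_neg (p + v), key, ← sub_eq_add_neg]; exact h.clear_start
  · rw [mem_shiftCells, sub_eq_add_neg (p + v + d), key2, ← sub_eq_add_neg]; exact h.clear_goal
  · rw [mem_shiftCells, mem_shiftCells, key, key2]; exact h.support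

theorem Touches.translate_iff {S : Finset Cell} {p v : Cell} :
    Touches (shiftCells v S) (p + v) ↔ Touches S p := by
  constructor
  · rintro ⟨s, hs, h⟩
    refine ⟨s - v, mem_shiftCells.1 hs, ?_⟩
    rw [gridGraph_adj_iff] at h ⊢
    rw [← h]; simp only [Prod.fst_add, Prod.snd_add, Prod.fst_sub, Prod.snd_sub]; congr 2 <;> ring
  · rintro ⟨s, hs, h⟩
    refine ⟨s + v, by simpa using hs, ?_⟩
    rw [gridGraph_adj_iff] at h ⊢
    rw [← h]; simp

theorem RestrictiveMove.translate {S : Finset Cell} {p q : Cell} (h : RestrictiveMove S p q)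
    (v : Cell) : RestrictiveMove (shiftCells v S) (p + v) (q + v) := by
  have key : ∀ x, p + v + x - v = p + x := fun x => by abel
  have key2 : ∀ x y, p + v + x + y - v = p + x + y := fun x y => by abel
  have key3 : ∀ x, p + v + x = p + x + v := fun x => by abel
  obtain ⟨d, e, h1, hs, h⟩ := h
  refine ⟨d, e, h1.translate v, by rw [mem_shiftCells, key]; exact hs, ?_⟩
  rw [mem_shiftCells, key2]
  rcases h with ⟨hs', rfl⟩ | ⟨hs', h2, rfl⟩
  · exact Or.inl ⟨hs', by abel⟩
  · refine Or.inr ⟨hs', ?_, by abel⟩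
    rw [key3]; exact h2.translate v

theorem LeapfrogMove.translate {S : Finset Cell} {p q : Cell} (h : LeapfrogMove S p q)
    (v : Cell) : LeapfrogMove (shiftCells v S) (p + v) (q + v) := by
  refine h.imp (fun h => h.translate v) ?_
  rintro ⟨d, e, h1, rfl, h2, h3⟩
  exact ⟨d, e, h1.translate v, by abel, Touches.translate_iff.2 h2, Touches.translate_iff.2 h3⟩

theorem MonkeyMove.translate {S : Finset Cell} {p q : Cell} (h : MonkeyMove S p q)
    (v : Cell) : MonkeyMove (shiftCells v S) (p + v) (q + v) := by
  have key3 : ∀ x, p + v + x = p + x + v := fun x => by abel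
  refine h.imp (fun h => h.translate v) ?_
  rintro ⟨d, e, d', e', h1, h2, rfl, t1, t2, t3⟩
  refine ⟨d, e, d', e', h1.translate v, ?_, by abel, Touches.translate_iff.2 t1, ?_,
    Touches.translate_iff.2 t3⟩
  · rw [key3]; exact h2.translate v
  · rw [key3, Touches.translate_iff]; exact t2

theorem MoveSet.Move.translate {M : MoveSet} {S : Finset Cell} {p q : Cell} (h : M.Move S p q)
    (v : Cell) : M.Move (shiftCells v S) (p + v) (q + v) := by
  cases M
  · exact RestrictiveMove.translate h v
  · exact LeapfrogMove.translate h v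
  · exact MonkeyMove.translate h v

theorem PivotStep.translate {M : MoveSet} {C C' : Finset Cell} (h : PivotStep M C C')
    (v : Cell) : PivotStep M (shiftCells v C) (shiftCells v C') := by
  obtain ⟨p, hp, q, hc, hm, rfl⟩ := h
  have he : (shiftCells v C).erase (p + v) = shiftCells v (C.erase p) := by
    ext x; simp [sub_eq_iff_eq_add]
  refine ⟨p + v, by simpa using hp, q + v, ?_, ?_, ?_⟩
  · rw [he]; exact hc.translate v
  · rw [he]; exact hm.translate v
  · rw [he]; ext x; simp [sub_eq_iff_eq_add]

/-! ### Shapes -/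

/-- The shape of a configuration. -/
def Configuration.shape {n : ℕ} (C : Configuration n) : Shape n :=
  Quotient.mk (translationSetoid n) C

theorem Configuration.shape_eq_iff {n : ℕ} {C D : Configuration n} :
    C.shape = D.shape ↔ ∃ v : Cell, ∀ p : Cell, p ∈ C.1 ↔ p + v ∈ D.1 :=
  Quotient.eq (r := translationSetoid n)

/-- The shapes that have a placement between `F` and `A`. -/
def shapesBetween (n : ℕ) (F A : Finset Cell) : Set (Shape n) :=
  {X | ∃ C : Configuration n, C.shape = X ∧ F ⊆ C.1 ∧ C.1 ⊆ A}

theorem Enclosure.adj_shapesBetween {F A : Finset Cell} (h : Enclosure F A) {M : MoveSet} {n : ℕ}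
    {X Y : Shape n} (hX : X ∈ shapesBetween n F A) (hXY : (reconfGraph M n).Adj X Y) :
    Y ∈ shapesBetween n F A := by
  have key : ∃ C D : Configuration n, C.shape = X ∧ D.shape = Y ∧ PivotStep M C.1 D.1 := by
    rcases (SimpleGraph.fromRel_adj _ _ _).1 hXY |>.2 with h | ⟨C, D, hC, hD, h⟩
    · exact h
    · exact ⟨D, C, hD, hC, h.reverse⟩
  obtain ⟨C, D, hC, rfl, hCD⟩ := key
  obtain ⟨B, hB, hFB, hBA⟩ := hX
  obtain ⟨v, hv⟩ := Configuration.shape_eq_iff.1 (hC.trans hB.symm)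
  have hBC : B.1 = shiftCells v C.1 := by ext p; rw [mem_shiftCells, hv]; simp
  -- The step starts from some placement of the shape; it is carried to the placement lying between
  -- `F` and `A`.
  have hD' : PivotStep M B.1 (shiftCells v D.1) := by rw [hBC]; exact hCD.translate v
  refine ⟨⟨shiftCells v D.1, ?_, D.2.2.translate v⟩, ?_, h.pivotStep hFB hBA hD'⟩
  · rw [shiftCells, Finset.card_map]; exact D.2.1
  · refine (Configuration.shape_eq_iff.2 ⟨v, fun p => ?_⟩).symm
    simp

theorem Enclosure.reachable_shapesBetween {F A : Finset Cell} (h : Enclosure F A) {M : MoveSet}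
    {n : ℕ} {X Y : Shape n} (hX : X ∈ shapesBetween n F A)
    (hXY : (reconfGraph M n).Reachable X Y) : Y ∈ shapesBetween n F A := by
  obtain ⟨w⟩ := hXY
  induction w with
  | nil => exact hX
  | cons hadj _ ih => exact ih (h.adj_shapesBetween hX hadj)

/-! ### Sets of cells given by columns

A list of natural numbers describes a set of cells in the first quadrant: cell `(x, y)`, where
`y < 16`, is present when the binary digit `y` of the entry `x` is one. -/

/-- The cell `(x, y)` is present in the list of columns `u`. -/
def present (u : List ℕ) (x y : ℕ) : Bool := decide (y < 16) && (u.getD x 0).testBit y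

theorem present_lt_length {u : List ℕ} {x y : ℕ} (h : present u x y) : x < u.length := by
  by_contra hx
  rw [present, List.getD_eq_default _ _ (not_lt.1 hx)] at h
  simp at h

theorem present_lt_height {u : List ℕ} {x y : ℕ} (h : present u x y) : y < 16 := by
  simp only [present, Bool.and_eq_true, decide_eq_true_eq] at h
  exact h.1

theorem present_append_right (u v : List ℕ) (x y : ℕ) :
    present (u ++ v) (u.length + x) y = present v x y := by
  rw [present, List.getD_append_right _ _ _ _ (Nat.le_add_right _ _), Nat.add_sub_cancel_left,
    present]

theorem present_append_left {u : List ℕ} (v : List ℕ) {x : ℕ} (y : ℕ) (h : x < u.length) :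
    present (u ++ v) x y = present u x y := by
  rw [present, List.getD_append _ _ _ _ h, present]

/-- The set of cells described by a list of columns. -/
def cells (u : List ℕ) : Finset Cell :=
  ((Finset.range u.length ×ˢ Finset.range 16).filter (fun q => present u q.1 q.2)).map
    ⟨fun q => ((q.1 : ℤ), (q.2 : ℤ)), fun a b h => by
      simpa [Prod.ext_iff] using h⟩

theorem mem_cells {u : List ℕ} {p : Cell} :
    p ∈ cells u ↔ ∃ x y : ℕ, p = ((x : ℤ), (y : ℤ)) ∧ present u x y := by
  simp only [cells, Finset.mem_map, Finset.mem_filter, Finset.mem_product, Finset.mem_range,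
    Prod.exists]
  constructor
  · rintro ⟨x, y, ⟨-, h⟩, rfl⟩; exact ⟨x, y, rfl, h⟩
  · rintro ⟨x, y, rfl, h⟩
    exact ⟨x, y, ⟨⟨present_lt_length h, present_lt_height h⟩, h⟩, rfl⟩

@[simp] theorem natCast_mem_cells {u : List ℕ} {x y : ℕ} :
    (((x : ℤ), (y : ℤ)) : Cell) ∈ cells u ↔ present u x y := by
  rw [mem_cells]
  constructor
  · rintro ⟨x', y', h, h'⟩
    obtain ⟨h1, h2⟩ := Prod.ext_iff.1 h
    simp only [Nat.cast_inj] at h1 h2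
    rwa [h1, h2]
  · intro h; exact ⟨x, y, rfl, h⟩

theorem cells_subset {u v : List ℕ} (h : ∀ x y, present u x y → present v x y) :
    cells u ⊆ cells v := by
  intro p hp
  obtain ⟨x, y, rfl, hxy⟩ := mem_cells.1 hp
  exact natCast_mem_cells.2 (h x y hxy)

/-- The number of cells of a column. -/
def columnCard (c : ℕ) : ℕ := ((Finset.range 16).filter (fun y => c.testBit y)).card

theorem card_cells (u : List ℕ) : (cells u).card = (u.map columnCard).sum := by
  have h : (cells u).card = ∑ x ∈ Finset.range u.length,
      ((Finset.range 16).filter (fun y => present u x y)).card := by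
    rw [cells, Finset.card_map, Finset.card_filter, Finset.sum_product]
    exact Finset.sum_congr rfl fun x _ => (Finset.card_filter _ _).symm
  rw [h]
  clear h
  induction u with
  | nil => simp
  | cons c u ih =>
    rw [List.length_cons, Finset.sum_range_succ', List.map_cons, List.sum_cons, add_comm, ← ih]
    refine congrArg₂ _ (congrArg Finset.card (Finset.filter_congr fun y hy => ?_)) rfl
    simp [present, Finset.mem_range.1 hy]

theorem card_cells_append (u v : List ℕ) :
    (cells (u ++ v)).card = (cells u).card + (cells v).card := by
  simp [card_cells]

/-! ### Patterns I and Z in terms of three successive columns -/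

/-- No pattern I or Z occupies the three successive columns `a`, `b`, `c`, its leftmost column
being `a`. -/
def goodWindow (a b c : ℕ) : Bool :=
  (List.range 16).all fun y =>
    let A := present [a]; let B := present [b]; let C := present [c]
    (!(A 0 y && C 0 y) || B 0 y) &&
    (!(A 0 y && A 0 (y + 2)) || A 0 (y + 1)) &&
    (!(A 0 y && C 0 (y + 1)) || (B 0 y || B 0 (y + 1))) &&
    (!(A 0 (y + 1) && C 0 y) || (B 0 y || B 0 (y + 1))) &&
    (!(A 0 y && B 0 (y + 2)) || (A 0 (y + 1) || B 0 (y + 1))) &&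
    (!(A 0 (y + 2) && B 0 y) || (A 0 (y + 1) || B 0 (y + 1)))

/-- All windows of three successive columns are good. -/
def goodWindows : List ℕ → Bool
  | a :: b :: c :: l => goodWindow a b c && goodWindows (b :: c :: l)
  | _ => true

/-- A window has three columns, so with two columns in common every window lies within one of the
two lists. -/
theorem goodWindows_glue {s : ℕ} : ∀ {u v : List ℕ}, goodWindows (u ++ [s, s]) →
    goodWindows (s :: s :: v) → goodWindows (u ++ s :: s :: v)
  | [], _, _, h => h
  | [a], v, h1, h2 => by
    simp only [List.cons_append, List.nil_append, goodWindows, Bool.and_true,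
      Bool.and_eq_true] at h1 ⊢
    exact ⟨h1, h2⟩
  | [a, b], v, h1, h2 => by
    simp only [List.cons_append, List.nil_append, goodWindows, Bool.and_true,
      Bool.and_eq_true] at h1 ⊢
    exact ⟨h1.1, h1.2, h2⟩
  | a :: b :: c :: u, v, h1, h2 => by
    simp only [List.cons_append, goodWindows, Bool.and_eq_true] at h1 ⊢
    exact ⟨h1.1, goodWindows_glue (u := b :: c :: u) h1.2 h2⟩

/-- The two empty columns provide the windows that overhang the right end; further right all columns
are empty. -/
theorem goodWindow_getD : ∀ {u : List ℕ}, goodWindows (u ++ [0, 0]) → ∀ x,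
    goodWindow (u.getD x 0) (u.getD (x + 1) 0) (u.getD (x + 2) 0)
  | [], _, x => by simpa using (by decide : goodWindow 0 0 0 = true)
  | [a], h, 0 => by simpa [goodWindows] using h
  | [a, b], h, 0 => by
    simp only [List.cons_append, List.nil_append, goodWindows, Bool.and_true,
      Bool.and_eq_true] at h
    simpa using h.1
  | a :: b :: c :: u, h, 0 => by
    simp only [List.cons_append, goodWindows, Bool.and_eq_true] at h
    simpa using h.1
  | [a], h, x + 1 => by simpa using (by decide : goodWindow 0 0 0 = true)
  | [a, b], h, x + 1 => by
    simp only [List.cons_append, List.nil_append, goodWindows, Bool.and_true,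
      Bool.and_eq_true] at h
    simpa using goodWindow_getD (u := [b]) (by simpa [goodWindows] using h.2) x
  | a :: b :: c :: u, h, x + 1 => by
    simp only [List.cons_append, goodWindows, Bool.and_eq_true] at h
    simpa using goodWindow_getD (u := b :: c :: u) h.2 x

theorem present_singleton (u : List ℕ) (x y : ℕ) :
    present [u.getD x 0] 0 y = present u x y := by simp [present]

/-- The meaning of good windows. -/
theorem goodWindows_present {u : List ℕ} (h : goodWindows (u ++ [0, 0])) (x y : ℕ) :
    (present u x y → present u (x + 2) y → present u (x + 1) y) ∧
    (present u x y → present u x (y + 2) → present u x (y + 1)) ∧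
    (present u x y → present u (x + 2) (y + 1) →
      present u (x + 1) y ∨ present u (x + 1) (y + 1)) ∧
    (present u x (y + 1) → present u (x + 2) y →
      present u (x + 1) y ∨ present u (x + 1) (y + 1)) ∧
    (present u x y → present u (x + 1) (y + 2) →
      present u x (y + 1) ∨ present u (x + 1) (y + 1)) ∧
    (present u x (y + 2) → present u (x + 1) y →
      present u x (y + 1) ∨ present u (x + 1) (y + 1)) := by
  by_cases hy : y < 16
  · have := List.all_eq_true.1 (goodWindow_getD h x) y (List.mem_range.2 hy)
    simp only [present_singleton] at this
    generalize present u x y = a1, present u x (y + 1) = a2,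
      present u x (y + 2) = a3, present u (x + 1) y = b1,
      present u (x + 1) (y + 1) = b2, present u (x + 1) (y + 2) = b3,
      present u (x + 2) y = c1, present u (x + 2) (y + 1) = c2 at this ⊢
    grind
  · have key : ∀ x k, present u x (y + k) = false := by
      intro x k
      rw [Bool.eq_false_iff]
      exact fun h => hy (by have := present_lt_height h; omega)
    simp [key x 1, key x 2, key (x + 1) 1, key (x + 1) 2,
      key (x + 2) 1, (by simpa using key x 0 : present u x y = false),
      (by simpa using key (x + 1) 0 : present u (x + 1) y = false),
      (by simpa using key (x + 2) 0 : present u (x + 2) y = false)]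

theorem not_hasPatternI_cells {u : List ℕ} (h : goodWindows (u ++ [0, 0])) :
    ¬ HasPatternI (cells u) := by
  have hor : ∀ p : Cell, p ∈ cells u → p + (1, 0) + (1, 0) ∈ cells u → p + (1, 0) ∈ cells u := by
    intro p hp hq
    obtain ⟨x, y, rfl, h1⟩ := mem_cells.1 hp
    have h2 := (goodWindows_present h x y).1 h1 (natCast_mem_cells.1 (by
      convert hq using 1; ext <;> simp; ring))
    convert natCast_mem_cells.2 h2 using 1; ext <;> simp
  have ver : ∀ p : Cell, p ∈ cells u → p + (0, 1) + (0, 1) ∈ cells u → p + (0, 1) ∈ cells u := by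
    intro p hp hq
    obtain ⟨x, y, rfl, h1⟩ := mem_cells.1 hp
    have h2 := (goodWindows_present h x y).2.1 h1 (natCast_mem_cells.1 (by
      convert hq using 1; ext <;> simp; ring))
    convert natCast_mem_cells.2 h2 using 1; ext <;> simp
  rintro ⟨p, d, hd, h1, h2, h3⟩
  rcases hd with rfl | rfl | rfl | rfl
  · exact h2 (hor p h1 h3)
  · refine h2 ?_
    have := hor (p + (-1, 0) + (-1, 0)) h3 (by
      convert h1 using 1; ext <;> simp)
    convert this using 1; ext <;> simp
  · exact h2 (ver p h1 h3)
  · refine h2 ?_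
    have := ver (p + (0, -1) + (0, -1)) h3 (by
      convert h1 using 1; ext <;> simp)
    convert this using 1; ext <;> simp

/-- A half turn exchanges the two ends of the Z-tetromino, so the eight pairs of directions reduce
to the four cases `hu`, `hd`, `vu`, `vd`: horizontal or vertical, rising or falling from left to
right. -/
theorem not_hasPatternZ_cells {u : List ℕ} (h : goodWindows (u ++ [0, 0])) :
    ¬ HasPatternZ (cells u) := by
  have hu : ∀ a b : ℤ, (a, b) ∈ cells u → (a + 2, b + 1) ∈ cells u →
      (a + 1, b) ∈ cells u ∨ (a + 1, b + 1) ∈ cells u := by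
    intro a b h1 h2
    obtain ⟨x, y, hxy, h3⟩ := mem_cells.1 h1
    obtain ⟨rfl, rfl⟩ := Prod.ext_iff.1 hxy
    have := (goodWindows_present h x y).2.2.1 h3 (natCast_mem_cells.1 (by exact_mod_cast h2))
    exact_mod_cast this.imp natCast_mem_cells.2 natCast_mem_cells.2
  have hd : ∀ a b : ℤ, (a, b + 1) ∈ cells u → (a + 2, b) ∈ cells u →
      (a + 1, b) ∈ cells u ∨ (a + 1, b + 1) ∈ cells u := by
    intro a b h1 h2
    obtain ⟨x', y, hxy, h2⟩ := mem_cells.1 h2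
    obtain ⟨x, y', hxy', -⟩ := mem_cells.1 h1
    simp only [Prod.mk.injEq] at hxy hxy'
    obtain ⟨h3, rfl⟩ := hxy
    obtain ⟨rfl, -⟩ := hxy'
    obtain rfl : x' = x + 2 := by omega
    have := (goodWindows_present h x y).2.2.2.1 (natCast_mem_cells.1 (by exact_mod_cast h1)) h2
    exact_mod_cast this.imp natCast_mem_cells.2 natCast_mem_cells.2
  have vu : ∀ a b : ℤ, (a, b) ∈ cells u → (a + 1, b + 2) ∈ cells u →
      (a, b + 1) ∈ cells u ∨ (a + 1, b + 1) ∈ cells u := by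
    intro a b h1 h2
    obtain ⟨x, y, hxy, h3⟩ := mem_cells.1 h1
    obtain ⟨rfl, rfl⟩ := Prod.ext_iff.1 hxy
    have := (goodWindows_present h x y).2.2.2.2.1 h3 (natCast_mem_cells.1 (by exact_mod_cast h2))
    exact_mod_cast this.imp natCast_mem_cells.2 natCast_mem_cells.2
  have vd : ∀ a b : ℤ, (a, b + 2) ∈ cells u → (a + 1, b) ∈ cells u →
      (a, b + 1) ∈ cells u ∨ (a + 1, b + 1) ∈ cells u := by
    intro a b h1 h2
    obtain ⟨x', y, hxy, h2⟩ := mem_cells.1 h2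
    obtain ⟨x, y', hxy', -⟩ := mem_cells.1 h1
    simp only [Prod.mk.injEq] at hxy hxy'
    obtain ⟨h3, rfl⟩ := hxy
    obtain ⟨rfl, -⟩ := hxy'
    obtain rfl : x' = x + 1 := by omega
    have := (goodWindows_present h x y).2.2.2.2.2 (natCast_mem_cells.1 (by exact_mod_cast h1)) h2
    exact_mod_cast this.imp natCast_mem_cells.2 natCast_mem_cells.2
  rintro ⟨⟨a, b⟩, d, e, ⟨hd', he', hde⟩, h1, h2, h3, h4⟩
  rcases hd' with rfl | rfl | rfl | rfl <;> rcases he' with rfl | rfl | rfl | rfl <;>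
    first
    | (exfalso; revert hde; norm_num; done)
    | skip
  all_goals simp only [Prod.mk_add_mk, add_zero] at h2 h3 h4
  · have := hu a b h1 (by convert h4 using 2; omega)
    tauto
  · have := hd a (b - 1) (by simpa using h1) (by convert h4 using 2 <;> omega)
    simp only [sub_add_cancel, ← sub_eq_add_neg] at *
    tauto
  · have := hd (a - 2) b (by convert h4 using 2; omega) (by simpa using h1)
    rw [show a - 2 + 1 = a + -1 by ring] at this
    tauto
  · have := hu (a - 2) (b - 1) (by convert h4 using 2 <;> omega) (by simpa using h1)
    rw [show a - 2 + 1 = a + -1 by ring, sub_add_cancel, sub_eq_add_neg] at this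
    tauto
  · have := vu a b h1 (by convert h4 using 2; omega)
    tauto
  · have := vd (a - 1) b (by convert h4 using 2 <;> omega) (by simpa using h1)
    simp only [sub_add_cancel, ← sub_eq_add_neg] at *
    tauto
  · have := vd a (b - 2) (by simpa using h1) (by convert h4 using 2; omega)
    rw [show b - 2 + 1 = b + -1 by ring] at this
    tauto
  · have := vu (a - 1) (b - 2) (by convert h4 using 2 <;> omega) (by simpa using h1)
    rw [show b - 2 + 1 = b + -1 by ring, sub_add_cancel, sub_eq_add_neg] at this
    tauto

/-! ### Boards

The columns of a list, written one after the other as a single natural number in base `2 ^ 16`. -/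

/-- The number whose digits in base `2 ^ 16` are the columns. -/
def board (u : List ℕ) : ℕ := u.foldr (fun c b => 2 ^ 16 * b + c) 0

theorem testBit_board : ∀ {u : List ℕ}, (∀ c ∈ u, c < 2 ^ 16) → ∀ {x y : ℕ}, y < 16 →
    (board u).testBit (16 * x + y) = present u x y
  | [], _, x, y, _ => by simp [board, present]
  | c :: u, hu, x, y, hy => by
    have hc := hu c (by simp)
    have ih := fun x => testBit_board (u := u) (fun c hc => hu c (by simp [hc])) (x := x) hy
    rw [board, List.foldr_cons, ← board, Nat.testBit_two_pow_mul_add _ hc]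
    cases x with
    | zero => simp [hy, present]
    | succ x =>
      rw [if_neg (by omega), show 16 * (x + 1) + y - 16 = 16 * x + y by omega, ih]
      simp [present]

/-- Spread `n` times from the cells of `Q` to the neighbouring cells in the board `B`. -/
def flood (B : ℕ) : ℕ → ℕ → ℕ
  | 0, Q => Q
  | n + 1, Q => flood B n (B &&& (Q ||| (Q <<< 1 ||| (Q >>> 1 ||| (Q <<< 16 ||| Q >>> 16)))))

/-- Whatever is flooded satisfies each property that spreads to neighbours. -/
theorem flood_induction {B : ℕ} {P : ℕ → Prop}
    (hP : ∀ a b, B.testBit a → B.testBit b → (b = a + 1 ∨ a = b + 1 ∨ b = a + 16 ∨ a = b + 16) →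
      P a → P b) :
    ∀ (n : ℕ) {Q : ℕ}, (∀ a, Q.testBit a → B.testBit a ∧ P a) →
      ∀ a, (flood B n Q).testBit a → P a
  | 0, _, hQ, a, ha => (hQ a ha).2
  | n + 1, Q, hQ, a, ha => by
    refine flood_induction hP n (fun b hb => ?_) a ha
    simp only [Nat.testBit_and, Nat.testBit_or, Nat.testBit_shiftLeft, Nat.testBit_shiftRight,
      Bool.and_eq_true, Bool.or_eq_true, decide_eq_true_eq] at hb
    obtain ⟨hB, hb⟩ := hb
    refine ⟨hB, ?_⟩
    rcases hb with h | ⟨h1, h⟩ | h | ⟨h1, h⟩ | h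
    · exact (hQ b h).2
    · exact hP _ b (hQ _ h).1 hB (by omega) (hQ _ h).2
    · exact hP _ b (hQ _ h).1 hB (by omega) (hQ _ h).2
    · exact hP _ b (hQ _ h).1 hB (by omega) (hQ _ h).2
    · exact hP _ b (hQ _ h).1 hB (by omega) (hQ _ h).2

/-! ### Tiles -/

/-- The building blocks of our configurations.  The caps end in a rectangular ring which is wrapped
by a path; the bumps are paths of the same size and width; the link is a single cell; the room is a
path that carries a rectangular ring and wraps it, with at most one module inside the ring. -/
inductive Tile : Type
  | leftCap
  | rightCap
  | bumpEarly
  | bumpLate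
  | link
  | room
  | roomLeft
  | roomRight

namespace Tile

/-- The columns of a tile.  All the successive tiles meet in the row `1`. -/
def occupied : Tile → List ℕ
  | leftCap => [2016, 1056, 7200, 5088, 5088, 7198, 1042, 2034, 2]
  | rightCap => [2, 2034, 1042, 7198, 5088, 5088, 7200, 1056, 2016]
  | bumpEarly => [2, 30, 16, 16, 30, 2, 2]
  | bumpLate => [2, 2, 30, 16, 16, 30, 2]
  | link => [2]
  | room => [2, 2046, 1056, 7200, 5088, 4640, 4640, 4640, 4640, 4640, 4640, 5088, 7198, 1042, 2034,
      2]
  | roomLeft => [2, 2046, 1056, 7200, 5088, 4640, 4640, 4704, 4640, 4640, 4640, 5088, 7198, 1042,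
      2034, 2]
  | roomRight => [2, 2046, 1056, 7200, 5088, 4640, 4640, 4640, 4704, 4640, 4640, 5088, 7198, 1042,
      2034, 2]

/-- The cells of a tile other than the module in its ring. -/
def frozen : Tile → List ℕ
  | roomLeft => room.occupied
  | roomRight => room.occupied
  | t => t.occupied

/-- A room with its ring filled. -/
def filledRoom : List ℕ :=
  [2, 2046, 1056, 7200, 5088, 5088, 5088, 5088, 5088, 5088, 5088, 5088, 7198, 1042, 2034, 2]

/-- The cells that the modules of a tile can ever reach. -/
def ambient : Tile → List ℕ
  | room => filledRoom
  | roomLeft => filledRoom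
  | roomRight => filledRoom
  | t => t.occupied

/-- The number of columns of a tile. -/
def width (t : Tile) : ℕ := t.occupied.length

theorem length_frozen (t : Tile) : t.frozen.length = t.width := by cases t <;> rfl
theorem length_ambient (t : Tile) : t.ambient.length = t.width := by cases t <;> rfl

/-- The index, in the board of a tile, of a cell where the tile meets its neighbour. -/
def seed : Tile → ℕ
  | leftCap => 16 * 8 + 1
  | _ => 1

/-- In the list `u`, the cell `(x, y)` is between two opposite cells, or it is a corner that faces a
cell across its outer vertex. -/
def blockedAt (u : List ℕ) (x y : ℕ) : Bool :=
  decide (1 ≤ x) && decide (1 ≤ y) &&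
  let c := present u
  (c (x + 1) y && c (x - 1) y) || (c x (y + 1) && c x (y - 1)) ||
  (c (x + 1) y && c x (y + 1) && c (x - 1) (y - 1)) ||
  (c (x + 1) y && c x (y - 1) && c (x - 1) (y + 1)) ||
  (c (x - 1) y && c x (y + 1) && c (x + 1) (y - 1)) ||
  (c (x - 1) y && c x (y - 1) && c (x + 1) (y + 1))

/-- The ambient cells of a tile without the one of index `a`. -/
def boardErase (t : Tile) (a : ℕ) : ℕ := board t.ambient ^^^ 2 ^ a

/-- The part of a tile that can be reached from its seed when the cell of index `a` is removed. -/
def side (t : Tile) (a : ℕ) : ℕ := flood (t.boardErase a) 100 (2 ^ t.seed)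

/-- The cell of index `a` separates the tile. -/
def cutAt (t : Tile) (a : ℕ) : Bool :=
  let A := t.boardErase a
  let Q := t.side a
  -- These two tests certify that no adjacency within `A` crosses the boundary of `Q`, so no
  -- property of `flood` is needed. The last two find frozen cells on both sides; these are present
  -- in every configuration considered.
  decide ((A &&& (A >>> 1)) &&& (Q ^^^ (Q >>> 1)) = 0) &&
  decide ((A &&& (A >>> 16)) &&& (Q ^^^ (Q >>> 16)) = 0) &&
  (List.range 16).any (fun x => (List.range 16).any fun y => present t.frozen x y &&
    decide (16 * x + y ≠ a) && Q.testBit (16 * x + y)) &&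
  (List.range 16).any (fun x => (List.range 16).any fun y => present t.frozen x y &&
    decide (16 * x + y ≠ a) && !Q.testBit (16 * x + y))

/-- The bound is `2 ^ 15` and not `2 ^ 16`: row `15` stays empty, which keeps the columns apart in a
board. -/
theorem lt_of_mem {t : Tile} {c : ℕ} :
    (c ∈ t.occupied → c < 2 ^ 15) ∧ (c ∈ t.ambient → c < 2 ^ 15) := by
  have h : ∀ t : Tile, (∀ c ∈ t.occupied, c < 2 ^ 15) ∧ (∀ c ∈ t.ambient, c < 2 ^ 15) := by
    intro t; cases t <;> decide +kernel
  exact ⟨(h t).1 c, (h t).2 c⟩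

theorem width_le (t : Tile) : 1 ≤ t.width ∧ t.width ≤ 16 := by cases t <;> decide

/-- The frozen cells of a tile are alone in their columns, or blocked, or cut cells. -/
theorem frozen_check (t : Tile) : ∀ x < 16, ∀ y < 16, present t.frozen x y →
    (t.frozen.getD x 0 = 2 ∧ t.ambient.getD x 0 = 2) ∨ blockedAt t.frozen x y ∨
      t.cutAt (16 * x + y) := by
  -- Blocking survives the addition of cells, hence is tested on `frozen`; separation survives the
  -- removal of nonfrozen cells, hence `cutAt` works with the ambient cells.
  cases t <;> decide +kernel

/-- The four neighbours of the cell `(x, y)` are present in the list `u`. -/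
def enclosedAt (u : List ℕ) (x y : ℕ) : Bool :=
  decide (1 ≤ x) && decide (1 ≤ y) && present u (x + 1) y && present u (x - 1) y &&
    present u x (y + 1) && present u x (y - 1)

/-- Only rooms have ambient cells that are not frozen: the interiors of their rings. -/
theorem enclosed_check (t : Tile) : ∀ x < 16, ∀ y < 16, present t.ambient x y →
    ¬ present t.frozen x y → enclosedAt t.ambient x y := by
  cases t <;> decide +kernel

theorem flood_check (t : Tile) :
    flood (board t.occupied) 100 (2 ^ t.seed) = board t.occupied ∧
      (board t.occupied).testBit t.seed := by
  cases t <;> decide +kernel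

theorem mono_check (t : Tile) : ∀ x < 16, ∀ y < 16,
    (present t.frozen x y → present t.occupied x y) ∧
      (present t.occupied x y → present t.ambient x y) := by
  cases t <;> decide +kernel

end Tile

/-! ### Words of tiles -/

/-- The cells of a word of tiles laid side by side, the columns of each tile being given by `g`. -/
def layout (g : Tile → List ℕ) (w : List Tile) : List ℕ := w.flatMap g

/-- The total width of a word of tiles. -/
def totalWidth (w : List Tile) : ℕ := (w.map Tile.width).sum

theorem length_layout {g : Tile → List ℕ} (hg : ∀ t, (g t).length = t.width) (w : List Tile) :
    (layout g w).length = totalWidth w := by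
  simp [layout, totalWidth, List.length_flatMap, hg]

theorem totalWidth_append (l r : List Tile) : totalWidth (l ++ r) = totalWidth l + totalWidth r := by
  simp [totalWidth]

theorem layout_split (g : Tile → List ℕ) (l r : List Tile) (t : Tile) :
    layout g (l ++ t :: r) = layout g l ++ (g t ++ layout g r) := by simp [layout]

/-- Reading the columns of a tile within a word. -/
theorem present_layout {g : Tile → List ℕ} (hg : ∀ t, (g t).length = t.width) (l r : List Tile)
    (t : Tile) {x : ℕ} (y : ℕ) (hx : x < t.width) :
    present (layout g (l ++ t :: r)) (totalWidth l + x) y = present (g t) x y := by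
  rw [layout_split, ← length_layout hg, present_append_right, present_append_left]
  rwa [hg]

theorem getD_layout {g : Tile → List ℕ} (hg : ∀ t, (g t).length = t.width) (l r : List Tile)
    (t : Tile) {x : ℕ} (hx : x < t.width) :
    (layout g (l ++ t :: r)).getD (totalWidth l + x) 0 = (g t).getD x 0 := by
  rw [layout_split, ← length_layout hg, List.getD_append_right _ _ _ _ (Nat.le_add_right _ _),
    Nat.add_sub_cancel_left, List.getD_append]
  rwa [hg]

theorem exists_tile : ∀ {w : List Tile} {x : ℕ}, x < totalWidth w →
    ∃ l t r i, w = l ++ t :: r ∧ x = totalWidth l + i ∧ i < t.width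
  | [], x, h => by simp [totalWidth] at h
  | t :: w, x, h => by
    by_cases hx : x < t.width
    · exact ⟨[], t, w, x, rfl, by simp [totalWidth], hx⟩
    · have h' : x - t.width < totalWidth w := by
        simp only [totalWidth, List.map_cons, List.sum_cons] at h ⊢; omega
      obtain ⟨l, t', r, i, rfl, h1, h2⟩ := exists_tile h'
      refine ⟨t :: l, t', r, i, rfl, ?_, h2⟩
      simp only [totalWidth, List.map_cons, List.sum_cons] at h1 ⊢; omega

theorem exists_tile_of_present {g : Tile → List ℕ} (hg : ∀ t, (g t).length = t.width)
    {w : List Tile} {x y : ℕ} (h : present (layout g w) x y) :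
    ∃ l t r i, w = l ++ t :: r ∧ x = totalWidth l + i ∧ i < t.width ∧ present (g t) i y := by
  have hx := present_lt_length h
  rw [length_layout hg] at hx
  obtain ⟨l, t, r, i, rfl, rfl, hi⟩ := exists_tile hx
  exact ⟨l, t, r, i, rfl, rfl, hi, by rwa [present_layout hg l r t y hi] at h⟩

theorem layout_mono {g g' : Tile → List ℕ} (hg : ∀ t, (g t).length = t.width)
    (hg' : ∀ t, (g' t).length = t.width)
    (h : ∀ t, ∀ x < 16, ∀ y < 16, present (g t) x y → present (g' t) x y) (w : List Tile) :
    cells (layout g w) ⊆ cells (layout g' w) := by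
  refine cells_subset fun x y hxy => ?_
  obtain ⟨l, t, r, i, rfl, rfl, hi, hp⟩ := exists_tile_of_present hg hxy
  rw [present_layout hg' l r t y hi]
  exact h t i (hi.trans_le t.width_le.2) y (present_lt_height hp) hp

theorem length_occupied (t : Tile) : t.occupied.length = t.width := rfl

theorem frozen_subset_occupied (w : List Tile) :
    cells (layout Tile.frozen w) ⊆ cells (layout Tile.occupied w) :=
  layout_mono Tile.length_frozen length_occupied (fun t x hx y hy => (t.mono_check x hx y hy).1) w

theorem occupied_subset_ambient (w : List Tile) :
    cells (layout Tile.occupied w) ⊆ cells (layout Tile.ambient w) :=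
  layout_mono length_occupied Tile.length_ambient (fun t x hx y hy => (t.mono_check x hx y hy).2) w

/-- A word of tiles with one cap at each end and no other caps. -/
structure Capped (w : List Tile) : Prop where
  split : ∀ l t r, w = l ++ t :: r → (l = [] ↔ t = .leftCap) ∧ (r = [] ↔ t = .rightCap)
  ne_nil : w ≠ []

theorem capped_of_mid {m : List Tile} (hm : ∀ t ∈ m, t ≠ .leftCap ∧ t ≠ .rightCap) :
    Capped (.leftCap :: (m ++ [.rightCap])) := by
  refine ⟨fun l t r h => ⟨⟨?_, ?_⟩, ⟨?_, ?_⟩⟩, by simp⟩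
  · rintro rfl
    exact (List.cons.inj h).1.symm
  · rintro rfl
    cases l with
    | nil => rfl
    | cons a l =>
      have h' : Tile.leftCap ∈ m ++ [.rightCap] := by
        rw [(List.cons.inj h).2]; simp
      rcases List.mem_append.1 h' with h' | h'
      · exact absurd rfl (hm _ h').1
      · simp at h'
  · rintro rfl
    rw [← List.cons_append] at h
    exact (List.singleton_inj.1 (List.append_inj_right' h rfl)).symm
  · rintro rfl
    rcases List.eq_nil_or_concat r with rfl | ⟨r, a, rfl⟩
    · rfl
    · rw [← List.cons_append, List.concat_eq_append, ← List.cons_append, ← List.append_assoc] at h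
      have h' : Tile.rightCap ∈ Tile.leftCap :: m := by
        rw [List.append_inj_left' h rfl]; simp
      rcases List.mem_cons.1 h' with h' | h'
      · cases h'
      · exact absurd rfl (hm _ h').2

namespace Tile

/-- The entry `2` is the single cell in row `1`, the only contact with the preceding tile. -/
theorem first_column {t : Tile} (ht : t ≠ leftCap) :
    t.frozen.getD 0 0 = 2 ∧ t.ambient.getD 0 0 = 2 ∧ t.occupied.getD 0 0 = 2 := by
  cases t <;> first | exact absurd rfl ht | decide

theorem last_column {t : Tile} (ht : t ≠ rightCap) :
    t.frozen.getD (t.width - 1) 0 = 2 ∧ t.ambient.getD (t.width - 1) 0 = 2 ∧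
      t.occupied.getD (t.width - 1) 0 = 2 := by
  cases t <;> first | exact absurd rfl ht | decide

end Tile

theorem present_of_getD {u : List ℕ} {x y : ℕ} (h : u.getD x 0 = 2) : present u x y ↔ y = 1 := by
  rw [present, h, Bool.and_eq_true, decide_eq_true_eq]
  constructor
  · rintro ⟨hy, h⟩; revert h; interval_cases y <;> decide
  · rintro rfl; decide

/-! ### Frozen cells -/

/-- Colourings of sets of cells in natural coordinates. -/
theorem not_facetConnected_of_colouring_nat {u : List ℕ} {S : Finset Cell} (hS : S ⊆ cells u)
    (κ : ℕ → ℕ → Bool)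
    (hv : ∀ x y : ℕ, (((x : ℤ), (y : ℤ)) : Cell) ∈ S → (((x : ℤ), ((y + 1 : ℕ) : ℤ)) : Cell) ∈ S →
      κ x y = κ x (y + 1))
    (hh : ∀ x y : ℕ, (((x : ℤ), (y : ℤ)) : Cell) ∈ S → ((((x + 1 : ℕ) : ℤ), (y : ℤ)) : Cell) ∈ S →
      κ x y = κ (x + 1) y)
    {a b a' b' : ℕ} (ha : (((a : ℤ), (b : ℤ)) : Cell) ∈ S) (ha' : (((a' : ℤ), (b' : ℤ)) : Cell) ∈ S)
    (h : κ a b = true) (h' : κ a' b' = false) : ¬ FacetConnected S := by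
  refine not_facetConnected_of_colouring (fun p => κ p.1.toNat p.2.toNat = true) ?_ ha ha'
    (by simpa using h) (by simpa using h')
  intro p hp q hq hpq
  obtain ⟨x, y, rfl, -⟩ := mem_cells.1 (hS hp)
  obtain ⟨x', y', rfl, -⟩ := mem_cells.1 (hS hq)
  rw [gridGraph_adj_iff] at hpq
  have hcases : (x' = x ∧ y' = y + 1) ∨ (x = x' ∧ y = y' + 1) ∨ (x' = x + 1 ∧ y' = y) ∨
      (x = x' + 1 ∧ y = y') := by
    simp only at hpq
    rcases abs_cases ((x : ℤ) - x') with h1 | h1 <;> rcases abs_cases ((y : ℤ) - y') with h2 | h2 <;>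
      omega
  simp only [Int.toNat_natCast]
  rcases hcases with ⟨rfl, rfl⟩ | ⟨rfl, rfl⟩ | ⟨rfl, rfl⟩ | ⟨rfl, rfl⟩
  · rw [hv _ _ hp hq]
  · rw [hv _ _ hq hp]
  · rw [hh _ _ hp hq]
  · rw [hh _ _ hq hp]

theorem testBit_agree {A Q a k : ℕ} (h : (A &&& (A >>> k)) &&& (Q ^^^ (Q >>> k)) = 0)
    (h1 : A.testBit a) (h2 : A.testBit (a + k)) : Q.testBit a = Q.testBit (a + k) := by
  have := congrArg (fun n => n.testBit a) h
  simp only [Nat.testBit_and, Nat.testBit_shiftRight, Nat.testBit_xor, Nat.zero_testBit,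
    Nat.add_comm k a, h1, h2, Bool.true_and] at this
  simpa using this

theorem Tile.testBit_boardErase {t : Tile} {x y i j : ℕ} (h : present t.ambient x y) (hj : j < 16)
    (hne : ¬ (x = i ∧ y = j)) : (t.boardErase (16 * i + j)).testBit (16 * x + y) := by
  have hy := present_lt_height h
  rw [Tile.boardErase, Nat.testBit_xor, testBit_board
    (fun c hc => (Tile.lt_of_mem.2 hc).trans (by norm_num)) hy, h, Nat.testBit_two_pow]
  have : ¬ (16 * i + j = 16 * x + y) := by omega
  simp [this]

section

variable {l r : List Tile} {t : Tile}

/-- A cell that separates its tile is a cut cell. -/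
theorem not_facetConnected_of_cutAt (hw : Capped (l ++ t :: r)) {i j : ℕ} (hi : i < t.width)
    (hj : j < 16) (hcut : t.cutAt (16 * i + j)) {C : Finset Cell}
    (hF : cells (layout Tile.frozen (l ++ t :: r)) ⊆ C)
    (hA : C ⊆ cells (layout Tile.ambient (l ++ t :: r))) :
    ¬ FacetConnected (C.erase (((totalWidth l + i : ℕ) : ℤ), (j : ℤ))) := by
  set P := totalWidth l with hP
  set W := t.width with hW
  set Q := t.side (16 * i + j) with hQ
  have hW1 : 1 ≤ W := t.width_le.1
  simp only [Tile.cutAt, Bool.and_eq_true, decide_eq_true_eq, List.any_eq_true,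
    List.mem_range, ← hQ] at hcut
  obtain ⟨⟨⟨hc1, hc2⟩, a, -, b, hb, ⟨hab, hab'⟩, habQ⟩, a', -, b', hb', ⟨hab1, hab1'⟩, habQ'⟩ :=
    hcut
  -- The two-colouring of the tile by `Q` is extended to the word: everything on the left takes the
  -- colour of the entry cell, everything on the right that of the exit cell.
  let κ : ℕ → ℕ → Bool := fun x y =>
    if x < P then Q.testBit 1 else if x < P + W then Q.testBit (16 * (x - P) + y)
      else Q.testBit (16 * (W - 1) + 1)
  have hκ : ∀ x y, x < W → κ (P + x) y = Q.testBit (16 * x + y) := by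
    intro x y hx; simp [κ, hx]
  have hmem : ∀ x y : ℕ, x < W → (((P + x : ℕ) : ℤ), (y : ℤ)) ∈
      C.erase (((P + i : ℕ) : ℤ), (j : ℤ)) →
      present t.ambient x y ∧ (t.boardErase (16 * i + j)).testBit (16 * x + y) := by
    intro x y hx hm
    obtain ⟨hne, hC⟩ := Finset.mem_erase.1 hm
    have hp := natCast_mem_cells.1 (hA hC)
    rw [present_layout Tile.length_ambient l r t y hx] at hp
    refine ⟨hp, Tile.testBit_boardErase hp hj ?_⟩
    rintro ⟨rfl, rfl⟩
    exact hne rfl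
  have hmemF : ∀ x y : ℕ, present t.frozen x y → 16 * x + y ≠ 16 * i + j →
      (((P + x : ℕ) : ℤ), (y : ℤ)) ∈ C.erase (((P + i : ℕ) : ℤ), (j : ℤ)) := by
    intro x y hp hne
    have hx := present_lt_length hp
    rw [Tile.length_frozen] at hx
    refine Finset.mem_erase.2 ⟨fun h => ?_, hF ?_⟩
    · simp only [Prod.mk.injEq, Nat.cast_inj] at h
      omega
    · rw [natCast_mem_cells, present_layout Tile.length_frozen l r t y hx]
      exact hp
  have hwd : ∀ {x y}, present t.frozen x y → x < W := fun h => by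
    have := present_lt_length h
    rwa [Tile.length_frozen] at this
  refine not_facetConnected_of_colouring_nat ((Finset.erase_subset _ _).trans hA) κ ?_ ?_
    (hmemF a b hab hab') (hmemF a' b' hab1 hab1')
    (by rw [hκ a b (hwd hab)]; exact habQ)
    (by rw [hκ a' b' (hwd hab1)]; simpa using habQ')
  · intro x y h1 h2
    by_cases hx : x < P
    · simp [κ, hx]
    by_cases hx' : x < P + W
    · obtain ⟨k, rfl⟩ := Nat.exists_eq_add_of_le (not_lt.1 hx)
      have hk : k < W := by omega
      rw [hκ _ _ hk, hκ _ _ hk]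
      exact testBit_agree hc1 (hmem _ _ hk h1).2 (hmem _ _ hk h2).2
    · simp [κ, hx, hx']
  · intro x y h1 h2
    rcases lt_trichotomy (x + 1) P with hx | hx | hx
    · have : x < P := by omega
      simp [κ, hx, this]
    · have hl : l ≠ [] := by
        rintro rfl
        simp [hP, totalWidth] at hx
      have ht : t ≠ .leftCap := fun h => hl ((hw.split l t r rfl).1.2 h)
      have h2' := (hmem 0 y (by omega) (by rwa [show x + 1 = P + 0 by omega] at h2)).1
      rw [present_of_getD (Tile.first_column ht).2.1] at h2'
      subst h2'
      have h3 : κ (x + 1) 1 = Q.testBit 1 := by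
        rw [hx]; simpa using hκ 0 1 (by omega)
      rw [h3]
      have : x < P := by omega
      simp [κ, this]
    · obtain ⟨k, rfl⟩ := Nat.exists_eq_add_of_le (show P ≤ x by omega)
      rcases lt_trichotomy (k + 1) W with hk | hk | hk
      · rw [hκ _ _ (by omega), add_assoc, hκ _ _ hk]
        rw [show 16 * (k + 1) + y = 16 * k + y + 16 by ring]
        refine testBit_agree hc2 (hmem _ _ (by omega) h1).2 ?_
        rw [show 16 * k + y + 16 = 16 * (k + 1) + y by ring]
        exact (hmem _ _ hk (by rw [← add_assoc]; exact h2)).2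
      · have hr : r ≠ [] := by
          rintro rfl
          have h2' := hA (Finset.mem_of_mem_erase h2)
          have h3 := present_lt_length (natCast_mem_cells.1 h2')
          rw [length_layout Tile.length_ambient, totalWidth_append] at h3
          simp only [totalWidth, List.map_cons, List.map_nil, List.sum_cons, List.sum_nil] at h3 hP
          omega
        have ht : t ≠ .rightCap := fun h => hr ((hw.split l t r rfl).2.2 h)
        have h1' := (hmem k y (by omega) h1).1
        have hk' : k = t.width - 1 := by omega
        rw [hk', present_of_getD (Tile.last_column ht).2.1] at h1'
        subst h1'
        rw [hκ _ _ (by omega)]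
        have e1 : ¬ (P + k + 1 < P) := by omega
        have e2 : ¬ (P + k + 1 < P + W) := by omega
        simp only [κ, e1, e2, if_false]
        rw [hk']
      · have e1 : ¬ (P + k + 1 < P) := by omega
        have e2 : ¬ (P + k + 1 < P + W) := by omega
        have e3 : ¬ (P + k < P) := by omega
        have e4 : ¬ (P + k < P + W) := by omega
        simp only [κ, e1, e2, e3, e4, if_false]

end

theorem Capped.exists_eq_leftCap_cons {w : List Tile} (hw : Capped w) :
    ∃ r, w = .leftCap :: r ∧ r ≠ [] := by
  obtain ⟨t, r, rfl⟩ := List.exists_cons_of_ne_nil hw.ne_nil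
  have h := hw.split [] t r rfl
  obtain rfl := h.1.1 rfl
  exact ⟨r, rfl, fun hr => by cases h.2.1 hr⟩

theorem Capped.exists_eq_append_rightCap {w : List Tile} (hw : Capped w) :
    ∃ l, w = l ++ [.rightCap] := by
  rcases List.eq_nil_or_concat w with rfl | ⟨l, t, rfl⟩
  · exact absurd rfl hw.ne_nil
  · rw [List.concat_eq_append] at hw ⊢
    exact ⟨l, by rw [(hw.split l t [] rfl).2.1 rfl]⟩

theorem Capped.present_first {w : List Tile} (hw : Capped w) :
    present (layout Tile.frozen w) 0 5 := by
  obtain ⟨r, rfl, -⟩ := hw.exists_eq_leftCap_cons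
  have := present_layout Tile.length_frozen [] r .leftCap (x := 0) 5 (by decide)
  simp only [totalWidth, List.map_nil, List.sum_nil, zero_add, List.nil_append] at this
  rw [this]; decide

theorem Capped.present_last {w : List Tile} (hw : Capped w) :
    present (layout Tile.frozen w) (totalWidth w - 1) 5 := by
  obtain ⟨l, rfl⟩ := hw.exists_eq_append_rightCap
  have h1 : totalWidth (l ++ [.rightCap]) - 1 = totalWidth l + 8 := by
    rw [totalWidth_append]; rfl
  rw [h1, present_layout Tile.length_frozen l [] .rightCap 5 (by decide)]
  decide

/-- A cell alone in its column is a cut cell. -/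
theorem not_facetConnected_of_column {w : List Tile} (hw : Capped w) {x : ℕ}
    (hx : x < totalWidth w) (hxF : (layout Tile.frozen w).getD x 0 = 2)
    (hxA : (layout Tile.ambient w).getD x 0 = 2) {C : Finset Cell}
    (hF : cells (layout Tile.frozen w) ⊆ C) (hA : C ⊆ cells (layout Tile.ambient w)) :
    ¬ FacetConnected (C.erase ((x : ℤ), ((1 : ℕ) : ℤ))) := by
  -- The extreme columns contain a cell in row `5`, so frozen cells remain on both sides of column
  -- `x`.
  have h0 : x ≠ 0 := by
    rintro rfl
    have := (present_of_getD hxF).1 hw.present_first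
    omega
  have h1 : x ≠ totalWidth w - 1 := by
    rintro rfl
    have := (present_of_getD hxF).1 hw.present_last
    omega
  have hmem : ∀ {a b : ℕ}, present (layout Tile.frozen w) a b → a ≠ x →
      (((a : ℤ), (b : ℤ)) : Cell) ∈ C.erase ((x : ℤ), ((1 : ℕ) : ℤ)) := by
    intro a b h hne
    refine Finset.mem_erase.2 ⟨fun h => hne ?_, hF (natCast_mem_cells.2 h)⟩
    simpa using (Prod.ext_iff.1 h).1
  refine not_facetConnected_of_colouring_nat ((Finset.erase_subset _ _).trans hA)
    (fun a _ => decide (a < x)) (fun a b _ _ => rfl) ?_ (hmem hw.present_first h0.symm)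
    (hmem hw.present_last h1.symm) (by simp; omega) (by simp; omega)
  intro a b _ h
  have hne : a + 1 ≠ x := by
    rintro rfl
    obtain ⟨h1, h2⟩ := Finset.mem_erase.1 h
    have := (present_of_getD hxA).1 (natCast_mem_cells.1 (hA h2))
    exact h1 (by rw [this])
  rw [decide_eq_decide]
  omega

/-- A blocked cell cannot turn. -/
theorem not_quarterTurn_of_blockedAt {u : List ℕ} {x y : ℕ} (h : Tile.blockedAt u x y)
    {C : Finset Cell} {P : ℕ}
    (hC : ∀ a b : ℕ, present u a b → (((P + a : ℕ) : ℤ), (b : ℤ)) ∈ C) (d e : Cell) :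
    ¬ QuarterTurn (C.erase (((P + x : ℕ) : ℤ), (y : ℤ))) (((P + x : ℕ) : ℤ), (y : ℤ)) d e := by
  simp only [Tile.blockedAt, Bool.and_eq_true, Bool.or_eq_true, decide_eq_true_eq, and_assoc] at h
  obtain ⟨hx, hy, h⟩ := h
  obtain ⟨x, rfl⟩ := Nat.exists_eq_add_of_le' hx
  obtain ⟨y, rfl⟩ := Nat.exists_eq_add_of_le' hy
  simp only [Nat.add_sub_cancel] at h
  have key : ∀ (a b : ℕ) (q : Cell), present u a b → q = (((P + a : ℕ) : ℤ), (b : ℤ)) →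
      q ≠ (((P + (x + 1) : ℕ) : ℤ), ((y + 1 : ℕ) : ℤ)) →
      q ∈ C.erase (((P + (x + 1) : ℕ) : ℤ), ((y + 1 : ℕ) : ℤ)) := by
    rintro a b q h rfl hne
    exact Finset.mem_erase.2 ⟨hne, hC a b h⟩
  have hperp : PerpDirs (1, 0) (0, 1) ∧ PerpDirs (1, 0) (0, -1) ∧ PerpDirs (-1, 0) (0, 1) ∧
      PerpDirs (-1, 0) (0, -1) := by
    simp [PerpDirs, IsDir]
  rcases h with ((((⟨h1, h2⟩ | ⟨h1, h2⟩) | ⟨h1, h2, h3⟩) | ⟨h1, h2, h3⟩) | ⟨h1, h2, h3⟩) |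
    ⟨h1, h2, h3⟩
  · exact not_quarterTurn_of_opposite (u := (1, 0)) (by simp [IsDir])
      (key _ _ _ h1 (by apply Prod.ext <;> dsimp <;> omega) (by simp))
      (key _ _ _ h2 (by apply Prod.ext <;> dsimp <;> omega) (by simp))
  · exact not_quarterTurn_of_opposite (u := (0, 1)) (by simp [IsDir])
      (key _ _ _ h1 (by apply Prod.ext <;> dsimp; omega) (by simp))
      (key _ _ _ h2 (by apply Prod.ext <;> dsimp <;> omega) (by simp))
  · exact not_quarterTurn_of_corner hperp.1
      (key _ _ _ h1 (by apply Prod.ext <;> dsimp <;> omega) (by simp))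
      (key _ _ _ h2 (by apply Prod.ext <;> dsimp; omega) (by simp))
      (key _ _ _ h3 (by apply Prod.ext <;> dsimp <;> omega) (by simp))
  · exact not_quarterTurn_of_corner hperp.2.1
      (key _ _ _ h1 (by apply Prod.ext <;> dsimp <;> omega) (by simp))
      (key _ _ _ h2 (by apply Prod.ext <;> dsimp <;> omega) (by simp))
      (key _ _ _ h3 (by apply Prod.ext <;> dsimp <;> omega) (by simp))
  · exact not_quarterTurn_of_corner hperp.2.2.1
      (key _ _ _ h1 (by apply Prod.ext <;> dsimp <;> omega) (by simp))
      (key _ _ _ h2 (by apply Prod.ext <;> dsimp; omega) (by simp))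
      (key _ _ _ h3 (by apply Prod.ext <;> dsimp <;> omega) (by simp))
  · exact not_quarterTurn_of_corner hperp.2.2.2
      (key _ _ _ h1 (by apply Prod.ext <;> dsimp <;> omega) (by simp))
      (key _ _ _ h2 (by apply Prod.ext <;> dsimp <;> omega) (by simp))
      (key _ _ _ h3 (by apply Prod.ext <;> dsimp <;> omega) (by simp))

/-- The frozen cells of a capped word enclose its other ambient cells. -/
theorem Capped.enclosure {w : List Tile} (hw : Capped w) :
    Enclosure (cells (layout Tile.frozen w)) (cells (layout Tile.ambient w)) where
  frozen := by
    intro p hp C hF hA hconn d e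
    obtain ⟨x, y, rfl, hxy⟩ := mem_cells.1 hp
    obtain ⟨l, t, r, i, rfl, rfl, hi, hiy⟩ := exists_tile_of_present Tile.length_frozen hxy
    have hy := present_lt_height hiy
    rcases t.frozen_check i (hi.trans_le t.width_le.2) y hy hiy with ⟨h1, h2⟩ | h | h
    · obtain rfl := (present_of_getD h1).1 hiy
      refine absurd hconn (not_facetConnected_of_column hw ?_ ?_ ?_ hF hA)
      · rw [totalWidth_append]
        simp only [totalWidth, List.map_cons, List.sum_cons]
        omega
      · rw [getD_layout Tile.length_frozen l r t hi, h1]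
      · rw [getD_layout Tile.length_ambient l r t hi, h2]
    · refine not_quarterTurn_of_blockedAt h (fun a b hab => hF ?_) d e
      have ha := present_lt_length hab
      rw [Tile.length_frozen] at ha
      rw [natCast_mem_cells, present_layout Tile.length_frozen l r t b ha]
      exact hab
    · exact absurd hconn (not_facetConnected_of_cutAt hw hi hy h hF hA)
  enclosed := by
    intro p hp hpF d hd
    obtain ⟨x, y, rfl, hxy⟩ := mem_cells.1 hp
    obtain ⟨l, t, r, i, rfl, rfl, hi, hiy⟩ := exists_tile_of_present Tile.length_ambient hxy
    have hnF : ¬ present t.frozen i y := by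
      rw [natCast_mem_cells, present_layout Tile.length_frozen l r t y hi] at hpF
      exact hpF
    have h := t.enclosed_check i (hi.trans_le t.width_le.2) y (present_lt_height hiy) hiy hnF
    simp only [Tile.enclosedAt, Bool.and_eq_true, decide_eq_true_eq, and_assoc] at h
    obtain ⟨hi1, hy1, h1, h2, h3, h4⟩ := h
    obtain ⟨i, rfl⟩ := Nat.exists_eq_add_of_le' hi1
    obtain ⟨y, rfl⟩ := Nat.exists_eq_add_of_le' hy1
    have key : ∀ (a b : ℕ) (q : Cell), present t.ambient a b →
        q = (((totalWidth l + a : ℕ) : ℤ), (b : ℤ)) →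
        q ∈ cells (layout Tile.ambient (l ++ t :: r)) := by
      rintro a b q h rfl
      have ha := present_lt_length h
      rw [Tile.length_ambient] at ha
      rw [natCast_mem_cells, present_layout Tile.length_ambient l r t b ha]
      exact h
    simp only [Nat.add_sub_cancel] at h2 h4
    rcases hd with rfl | rfl | rfl | rfl
    · exact key _ _ _ h1 (by apply Prod.ext <;> dsimp <;> omega)
    · exact key _ _ _ h2 (by apply Prod.ext <;> dsimp <;> omega)
    · exact key _ _ _ h3 (by apply Prod.ext <;> dsimp; omega)
    · exact key _ _ _ h4 (by apply Prod.ext <;> dsimp <;> omega)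

/-! ### Connectedness of words -/

section

variable {l r : List Tile} {t : Tile}

/-- The cell of index `k` of a tile that comes after the tiles `l`. -/
def tileCell (l : List Tile) (k : ℕ) : Cell := (((totalWidth l + k / 16 : ℕ) : ℤ), ((k % 16 : ℕ) : ℤ))

theorem testBit_board_occupied (t : Tile) (k : ℕ) :
    (board t.occupied).testBit k = present t.occupied (k / 16) (k % 16) := by
  rw [← testBit_board (fun c hc => (Tile.lt_of_mem.1 hc).trans (by norm_num))
    (Nat.mod_lt k (by norm_num)), Nat.div_add_mod]

theorem tileCell_mem {k : ℕ} (hk : present t.occupied (k / 16) (k % 16)) :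
    tileCell l k ∈ cells (layout Tile.occupied (l ++ t :: r)) := by
  rw [tileCell, natCast_mem_cells, present_layout length_occupied l r t _ (present_lt_length hk)]
  exact hk

/-- Indices differing by one could otherwise denote the top of a column and the bottom of the next.
-/
theorem Tile.mod_lt_of_present {k : ℕ} (hk : present t.occupied (k / 16) (k % 16)) :
    k % 16 < 15 := by
  by_contra h
  have h15 : k % 16 = 15 := by omega
  have hx := present_lt_length hk
  rw [h15, present, List.getD_eq_getElem _ _ hx, Nat.testBit_lt_two_pow
    ((Tile.lt_of_mem (t := t)).1 (List.getElem_mem hx))] at hk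
  simp at hk

/-- A tile is connected. -/
theorem reach_of_seed (l r : List Tile) (t : Tile) {k : ℕ}
    (hk : present t.occupied (k / 16) (k % 16)) :
    Relation.ReflTransGen (AdjIn (cells (layout Tile.occupied (l ++ t :: r))))
      (tileCell l t.seed) (tileCell l k) := by
  refine flood_induction (B := board t.occupied)
    (P := fun k => Relation.ReflTransGen (AdjIn (cells (layout Tile.occupied (l ++ t :: r))))
      (tileCell l t.seed) (tileCell l k)) ?_ 100 (Q := 2 ^ t.seed) ?_ k ?_
  · intro a b ha hb hab hP
    rw [testBit_board_occupied] at ha hb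
    refine hP.tail ⟨tileCell_mem ha, tileCell_mem hb, ?_⟩
    have h1 := Tile.mod_lt_of_present ha
    have h2 := Tile.mod_lt_of_present hb
    rw [gridGraph_adj_iff]
    simp only [tileCell]
    rcases hab with rfl | rfl | rfl | rfl
    · rw [show (a + 1) / 16 = a / 16 by omega, show (a + 1) % 16 = a % 16 + 1 by omega]
      simp
    · rw [show (b + 1) / 16 = b / 16 by omega, show (b + 1) % 16 = b % 16 + 1 by omega]
      simp
    · rw [show (a + 16) / 16 = a / 16 + 1 by omega, show (a + 16) % 16 = a % 16 by omega]
      simp [← add_assoc]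
    · rw [show (b + 16) / 16 = b / 16 + 1 by omega, show (b + 16) % 16 = b % 16 by omega]
      simp [← add_assoc]
  · intro a ha
    rw [Nat.testBit_two_pow, decide_eq_true_eq] at ha
    subst ha
    exact ⟨t.flood_check.2, Relation.ReflTransGen.refl⟩
  · rw [t.flood_check.1, testBit_board_occupied]
    exact hk

theorem Tile.seed_of_ne {t : Tile} (ht : t ≠ leftCap) : t.seed = 1 := by
  cases t <;> first | rfl | exact absurd rfl ht

end

/-- A word is connected. -/
theorem Capped.facetConnected {w : List Tile} (hw : Capped w) :
    FacetConnected (cells (layout Tile.occupied w)) := by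
  -- Induction on the number of preceding tiles: cross the previous tile to its last cell in row
  -- `1`, step to the seed, then spread within the tile.
  have key : ∀ n, ∀ l t r, l.length = n → w = l ++ t :: r → ∀ k,
      present t.occupied (k / 16) (k % 16) →
      Relation.ReflTransGen (AdjIn (cells (layout Tile.occupied w)))
        (tileCell [] Tile.leftCap.seed) (tileCell l k) := by
    intro n
    induction n with
    | zero =>
      intro l t r hl hw' k hk
      obtain rfl := List.length_eq_zero_iff.1 hl
      obtain rfl := (hw.split [] t r hw').1.1 rfl
      subst hw'
      exact reach_of_seed [] r _ hk
    | succ n ih =>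
      intro l t r hl hw' k hk
      rcases List.eq_nil_or_concat l with rfl | ⟨l, s, rfl⟩
      · simp at hl
      rw [List.concat_eq_append] at hl hw' ⊢
      have ht : t ≠ .leftCap := fun h => by
        have := (hw.split _ t r hw').1.2 h
        simp at this
      have hw'' : w = l ++ s :: (t :: r) := by rw [hw']; simp
      have hs : s ≠ .rightCap := fun h => by
        have := (hw.split _ s _ hw'').2.2 h
        simp at this
      have hs1 := s.width_le.1
      have hport : present s.occupied ((16 * (s.width - 1) + 1) / 16)
          ((16 * (s.width - 1) + 1) % 16) := by
        rw [show (16 * (s.width - 1) + 1) / 16 = s.width - 1 by omega,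
          show (16 * (s.width - 1) + 1) % 16 = 1 by omega,
          present_of_getD (Tile.last_column hs).2.2]
      have hseed : present t.occupied (t.seed / 16) (t.seed % 16) := by
        rw [← testBit_board_occupied]
        exact t.flood_check.2
      have h1 := ih l s (t :: r) (by simpa using hl) hw'' _ hport
      have h2 := reach_of_seed (l ++ [s]) r t hk
      rw [← hw'] at h2
      refine (h1.tail ⟨?_, ?_, ?_⟩).trans h2
      · rw [hw'']; exact tileCell_mem hport
      · rw [hw']; exact tileCell_mem hseed
      · rw [Tile.seed_of_ne ht, gridGraph_adj_iff]
        simp only [tileCell, totalWidth_append]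
        rw [show (16 * (s.width - 1) + 1) / 16 = s.width - 1 by omega,
          show (16 * (s.width - 1) + 1) % 16 = 1 by omega]
        simp [totalWidth, Nat.cast_sub hs1]
  obtain ⟨r, hr, -⟩ := hw.exists_eq_leftCap_cons
  refine facetConnected_of_reach (r := tileCell [] Tile.leftCap.seed) ?_ ?_
  · rw [hr]
    exact tileCell_mem (l := []) (by decide)
  · intro p hp
    obtain ⟨x, y, rfl, hxy⟩ := mem_cells.1 hp
    obtain ⟨l, t, r, i, hw', rfl, hi, hiy⟩ := exists_tile_of_present length_occupied hxy
    have hy := present_lt_height hiy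
    have e1 : (16 * i + y) / 16 = i := by omega
    have e2 : (16 * i + y) % 16 = y := by omega
    have := key _ l t r rfl hw' (16 * i + y) (by rw [e1, e2]; exact hiy)
    rwa [tileCell.eq_1 l, e1, e2] at this

/-! ### Absence of patterns I and Z in words -/

/-- The added columns `2` are the last one of the preceding tile and the first one of the next,
whatever these tiles are. -/
theorem Tile.goodWindows_mid {t : Tile} (ht : t ≠ leftCap ∧ t ≠ rightCap) :
    ∃ u, t.occupied = u ++ [2] ∧ goodWindows (2 :: u ++ [2, 2]) := by
  refine ⟨t.occupied.dropLast, ?_⟩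
  cases t <;> first | exact absurd rfl ht.1 | exact absurd rfl ht.2 | decide +kernel

theorem exists_layout_eq_cons {m : List Tile} (hm : ∀ t ∈ m, t ≠ .leftCap ∧ t ≠ .rightCap) :
    ∃ v, layout Tile.occupied (m ++ [.rightCap]) ++ [0, 0] = 2 :: v := by
  rcases m with _ | ⟨t, m⟩
  · exact ⟨_, rfl⟩
  · have ht := (hm t (by simp)).1
    have : ∃ v, t.occupied = 2 :: v := by
      cases t <;> first | exact ⟨_, rfl⟩ | exact absurd rfl ht
    obtain ⟨v, hv⟩ := this
    exact ⟨_, by simp only [layout, List.cons_append, List.flatMap_cons, hv]; rfl⟩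

theorem goodWindows_tail {m : List Tile} (hm : ∀ t ∈ m, t ≠ .leftCap ∧ t ≠ .rightCap) :
    goodWindows (2 :: (layout Tile.occupied (m ++ [.rightCap]) ++ [0, 0])) := by
  induction m with
  | nil => decide +kernel
  | cons t m ih =>
    have hm' : ∀ t ∈ m, t ≠ .leftCap ∧ t ≠ .rightCap := fun t ht => hm t (by simp [ht])
    obtain ⟨v, hv⟩ := exists_layout_eq_cons hm'
    obtain ⟨u, hu, hgu⟩ := Tile.goodWindows_mid (hm t (by simp))
    have ih := ih hm'
    rw [hv] at ih
    have := goodWindows_glue hgu ih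
    rw [← hv] at this
    simpa [layout, hu] using this

theorem goodWindows_word {m : List Tile} (hm : ∀ t ∈ m, t ≠ .leftCap ∧ t ≠ .rightCap) :
    goodWindows (layout Tile.occupied (.leftCap :: (m ++ [.rightCap])) ++ [0, 0]) := by
  obtain ⟨v, hv⟩ := exists_layout_eq_cons hm
  have ih := goodWindows_tail hm
  rw [hv] at ih
  have h0 : goodWindows (Tile.leftCap.occupied.dropLast ++ [2, 2]) := by decide +kernel
  have := goodWindows_glue h0 ih
  rw [← hv] at this
  simpa [layout, Tile.occupied] using this

/-! ### Moving the module of a room -/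

theorem cells_layout_replace {l r : List Tile} {t t' : Tile} (hw : t'.width = t.width) {i j : ℕ}
    (hi : i < t.width)
    (h : ∀ x < 16, ∀ y < 16, present t'.occupied x y ↔ present t.occupied x y ∨ (x = i ∧ y = j))
    (hj : j < 16) :
    cells (layout Tile.occupied (l ++ t' :: r)) =
      insert (((totalWidth l + i : ℕ) : ℤ), (j : ℤ)) (cells (layout Tile.occupied (l ++ t :: r))) := by
  have key : ∀ x y, present (layout Tile.occupied (l ++ t' :: r)) x y ↔
      (x = totalWidth l + i ∧ y = j) ∨ present (layout Tile.occupied (l ++ t :: r)) x y := by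
    intro x y
    have hl := length_layout length_occupied l
    rcases lt_or_ge x (totalWidth l) with hx | hx
    · rw [layout_split, layout_split, present_append_left _ _ (by rwa [hl]),
        present_append_left _ _ (by rwa [hl])]
      constructor
      · exact Or.inr
      · rintro (⟨rfl, -⟩ | h)
        · omega
        · exact h
    obtain ⟨x, rfl⟩ := Nat.exists_eq_add_of_le hx
    rcases lt_or_ge x t.width with hx | hx
    · rw [present_layout length_occupied _ _ _ _ hx, present_layout length_occupied _ _ _ _
        (by rwa [hw])]
      by_cases hy : y < 16
      · rw [h x (hx.trans_le t.width_le.2) y hy]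
        constructor
        · rintro (h | ⟨rfl, rfl⟩)
          · exact Or.inr h
          · exact Or.inl ⟨rfl, rfl⟩
        · rintro (⟨h1, h2⟩ | h)
          · exact Or.inr ⟨by omega, h2⟩
          · exact Or.inl h
      · constructor
        · intro h; exact absurd (present_lt_height h) hy
        · rintro (⟨-, h⟩ | h)
          · omega
          · exact absurd (present_lt_height h) hy
    · obtain ⟨x, rfl⟩ := Nat.exists_eq_add_of_le hx
      rw [layout_split, layout_split, ← hl, present_append_right, present_append_right]
      rw [show t.width + x = t.occupied.length + x from rfl, present_append_right,
        show t.occupied.length = t'.occupied.length from hw.symm, present_append_right]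
      constructor
      · exact Or.inr
      · rintro (⟨h, -⟩ | h)
        · have : t'.occupied.length = t.width := hw
          omega
        · exact h
  ext p
  rw [Finset.mem_insert]
  constructor
  · intro hp
    obtain ⟨x, y, rfl, hxy⟩ := mem_cells.1 hp
    rcases (key x y).1 hxy with ⟨rfl, rfl⟩ | h
    · exact Or.inl rfl
    · exact Or.inr (natCast_mem_cells.2 h)
  · rintro (rfl | hp)
    · exact natCast_mem_cells.2 ((key _ _).2 (Or.inl ⟨rfl, rfl⟩))
    · obtain ⟨x, y, rfl, hxy⟩ := mem_cells.1 hp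
      exact natCast_mem_cells.2 ((key x y).2 (Or.inr hxy))

/-- The static modules form the word with that room empty, which is connected. The loose module
rolls over two adjacent modules of the bottom side of the ring, with free cells above. -/
theorem pivotStep_room (M : MoveSet) {l r : List Tile} (hw : Capped (l ++ .room :: r)) :
    PivotStep M (cells (layout Tile.occupied (l ++ .roomLeft :: r)))
      (cells (layout Tile.occupied (l ++ .roomRight :: r))) := by
  have hL := cells_layout_replace (l := l) (r := r) (t := .room) (t' := .roomLeft) rfl
    (i := 7) (j := 6) (by decide) (by decide +kernel) (by decide)
  have hR := cells_layout_replace (l := l) (r := r) (t := .room) (t' := .roomRight) rfl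
    (i := 8) (j := 6) (by decide) (by decide +kernel) (by decide)
  set S := cells (layout Tile.occupied (l ++ .room :: r)) with hS
  set P := totalWidth l
  have key : ∀ (x y : ℕ), x < 16 → ((((P + x : ℕ) : ℤ), (y : ℤ)) ∈ S ↔
      present Tile.room.occupied x y) := by
    intro x y hx
    rw [natCast_mem_cells, present_layout length_occupied _ _ _ _ (show x < Tile.room.width from hx)]
  have hp : ((((P + 7 : ℕ) : ℤ), ((6 : ℕ) : ℤ)) : Cell) ∉ S := by
    rw [key 7 6 (by norm_num)]; decide
  have e1 : ((((P + 7 : ℕ) : ℤ), ((6 : ℕ) : ℤ)) : Cell) + (1, 0) =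
    (((P + 8 : ℕ) : ℤ), ((6 : ℕ) : ℤ)) := Prod.ext (by dsimp; omega) (by dsimp)
  have e2 : ((((P + 7 : ℕ) : ℤ), ((6 : ℕ) : ℤ)) : Cell) - (0, -1) =
    (((P + 7 : ℕ) : ℤ), ((7 : ℕ) : ℤ)) := Prod.ext (by dsimp; omega) (by dsimp)
  have e3 : ((((P + 8 : ℕ) : ℤ), ((6 : ℕ) : ℤ)) : Cell) - (0, -1) =
    (((P + 8 : ℕ) : ℤ), ((7 : ℕ) : ℤ)) := Prod.ext (by dsimp; omega) (by dsimp)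
  have e4 : ((((P + 7 : ℕ) : ℤ), ((6 : ℕ) : ℤ)) : Cell) + (0, -1) =
    (((P + 7 : ℕ) : ℤ), ((5 : ℕ) : ℤ)) := Prod.ext (by dsimp; omega) (by dsimp)
  have e5 : ((((P + 8 : ℕ) : ℤ), ((6 : ℕ) : ℤ)) : Cell) + (0, -1) =
    (((P + 8 : ℕ) : ℤ), ((5 : ℕ) : ℤ)) := Prod.ext (by dsimp; omega) (by dsimp)
  rw [hL, hR]
  refine ⟨_, Finset.mem_insert_self _ _, (((P + 8 : ℕ) : ℤ), ((6 : ℕ) : ℤ)), ?_, ?_, ?_⟩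
  · rw [Finset.erase_insert hp]
    exact hw.facetConnected
  · rw [Finset.erase_insert hp]
    refine RestrictiveMove.move ⟨(1, 0), (0, -1), ⟨?_, ?_, ?_, ?_, Or.inl ?_⟩, ?_, Or.inl ⟨?_, ?_⟩⟩ M
    · simp [PerpDirs, IsDir]
    · rw [e1, key 8 6 (by norm_num)]; decide
    · rw [e2, key 7 7 (by norm_num)]; decide
    · rw [e1, e3, key 8 7 (by norm_num)]; decide
    · rw [e4, key 7 5 (by norm_num)]; decide
    · rw [e4, key 7 5 (by norm_num)]; decide
    · rw [e1, e5, key 8 5 (by norm_num)]; decide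
    · exact e1.symm
  · rw [Finset.erase_insert hp]

/-! ### Telling words apart -/

/-- Every cell of the columns `u` is a cell of the columns `v`. -/
def ColumnsLE (u v : List ℕ) : Prop := ∀ x y, present u x y → present v x y

theorem ColumnsLE.of_cells_subset {u v : List ℕ} (h : cells u ⊆ cells v) : ColumnsLE u v :=
  fun _ _ hxy => natCast_mem_cells.1 (h (natCast_mem_cells.2 hxy))

theorem ColumnsLE.of_append {a b c d : List ℕ} (h : ColumnsLE (a ++ b) (c ++ d))
    (hl : a.length = c.length) : ColumnsLE a c ∧ ColumnsLE b d := by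
  constructor
  · intro x y hxy
    have hx := present_lt_length hxy
    have := h x y (by rwa [present_append_left _ _ hx])
    rwa [present_append_left _ _ (hl ▸ hx)] at this
  · intro x y hxy
    have := h (a.length + x) y (by rwa [present_append_right])
    rwa [hl, present_append_right] at this

/-- Tiles indexed by bits and of equal widths can be read off from the columns of a word. -/
theorem eq_of_columnsLE {tile : Bool → Tile} {G H : Tile → List ℕ}
    (hlen : ∀ b b', (G (tile b)).length = (H (tile b')).length)
    (hsep : ∀ b b', ColumnsLE (G (tile b)) (H (tile b')) → b = b') :
    ∀ {f f' : List Bool} {s s' : List ℕ}, f.length = f'.length →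
      ColumnsLE (layout G (f.map tile) ++ s) (layout H (f'.map tile) ++ s') → f = f'
  | [], [], _, _, _, _ => rfl
  | [], _ :: _, _, _, h, _ => by simp at h
  | _ :: _, [], _, _, h, _ => by simp at h
  | b :: f, b' :: f', s, s', hl, h => by
    simp only [layout, List.map_cons, List.flatMap_cons, List.append_assoc] at h
    obtain ⟨h1, h2⟩ := h.of_append (hlen b b')
    rw [hsep b b' h1, eq_of_columnsLE hlen hsep (by simpa using hl) h2]

/-- The two bumps. -/
def bump (b : Bool) : Tile := bif b then .bumpEarly else .bumpLate

/-- The two rooms with a module inside. -/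
def roomOf (b : Bool) : Tile := bif b then .roomLeft else .roomRight

theorem bump_sep (b b' : Bool) (h : ColumnsLE (bump b).frozen (bump b').ambient) : b = b' := by
  cases b <;> cases b'
  · rfl
  -- Columns `5` and `1` are where only the late, respectively only the early, bump rises to row
  -- `3`.
  · exact absurd (h 5 3 (by decide)) (by decide)
  · exact absurd (h 1 3 (by decide)) (by decide)
  · rfl

theorem roomOf_sep (b b' : Bool) (h : ColumnsLE (roomOf b).occupied (roomOf b').occupied) :
    b = b' := by
  cases b <;> cases b'
  · rfl
  · exact absurd (h 8 6 (by decide)) (by decide)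
  · exact absurd (h 7 6 (by decide)) (by decide)
  · rfl

/-- The tiles between the caps of `word f g r`. -/
def midTiles (f g : List Bool) (r : ℕ) : List Tile :=
  f.map bump ++ (g.map roomOf ++ List.replicate r .link)

/-- The word with the bumps `f`, the rooms `g` and `r` links. -/
def word (f g : List Bool) (r : ℕ) : List Tile := .leftCap :: (midTiles f g r ++ [.rightCap])

theorem midTiles_ne_cap {f g : List Bool} {r : ℕ} :
    ∀ t ∈ midTiles f g r, t ≠ .leftCap ∧ t ≠ .rightCap := by
  intro t ht
  simp only [midTiles, List.mem_append, List.mem_map, List.mem_replicate] at ht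
  rcases ht with ⟨b, -, rfl⟩ | ⟨b, -, rfl⟩ | ⟨-, rfl⟩
  · cases b <;> simp [bump]
  · cases b <;> simp [roomOf]
  · simp

theorem capped_word (f g : List Bool) (r : ℕ) : Capped (word f g r) :=
  capped_of_mid midTiles_ne_cap

theorem layout_word (G : Tile → List ℕ) (f g : List Bool) (r : ℕ) :
    layout G (word f g r) = G .leftCap ++ (layout G (f.map bump) ++ (layout G (g.map roomOf) ++
      layout G (List.replicate r .link ++ [.rightCap]))) := by
  simp [word, midTiles, layout]

theorem eq_of_frozen_le_ambient {f f' g g' : List Bool} {r r' : ℕ} (hl : f.length = f'.length)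
    (h : ColumnsLE (layout Tile.frozen (word f g r)) (layout Tile.ambient (word f' g' r'))) :
    f = f' := by
  rw [layout_word, layout_word] at h
  exact eq_of_columnsLE (fun b b' => by cases b <;> cases b' <;> rfl) bump_sep hl
    (h.of_append rfl).2

theorem eq_of_occupied_le {f g g' : List Bool} {r r' : ℕ} (hl : g.length = g'.length)
    (h : ColumnsLE (layout Tile.occupied (word f g r)) (layout Tile.occupied (word f g' r'))) :
    g = g' := by
  rw [layout_word, layout_word] at h
  exact eq_of_columnsLE (fun b b' => by cases b <;> cases b' <;> rfl) roomOf_sep hl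
    ((h.of_append rfl).2.of_append rfl).2

theorem card_cells_layout (G : Tile → List ℕ) (w : List Tile) :
    (cells (layout G w)).card = (w.map fun t => (cells (G t)).card).sum := by
  induction w with
  | nil => rfl
  | cons t w ih =>
    rw [layout, List.flatMap_cons, card_cells_append, ← layout, ih, List.map_cons, List.sum_cons]

theorem card_word (f g : List Bool) (r : ℕ) :
    (cells (layout Tile.occupied (word f g r))).card =
      86 + 13 * f.length + 67 * g.length + r := by
  have hb : ∀ b, (cells (bump b).occupied).card = 13 := by
    intro b; rw [card_cells]; cases b <;> decide +kernel
  have hr : ∀ b, (cells (roomOf b).occupied).card = 67 := by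
    intro b; rw [card_cells]; cases b <;> decide +kernel
  have h1 : (cells Tile.leftCap.occupied).card = 43 := by rw [card_cells]; decide +kernel
  have h2 : (cells Tile.rightCap.occupied).card = 43 := by rw [card_cells]; decide +kernel
  have h3 : (cells Tile.link.occupied).card = 1 := by rw [card_cells]; decide +kernel
  rw [card_cells_layout]
  simp only [word, midTiles, List.map_cons, List.map_append, List.map_map, List.sum_cons,
    List.sum_append, List.map_replicate, List.sum_replicate, List.map_nil, List.sum_nil, h1, h2, h3,
    Function.comp_def, hb, hr, List.map_const', smul_eq_mul]
  ring

/-! ### The shapes of words -/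

theorem present_first_column {w : List Tile} (hw : Capped w) {y : ℕ}
    (h : present (layout Tile.ambient w) 0 y) : 5 ≤ y := by
  obtain ⟨r, rfl, -⟩ := hw.exists_eq_leftCap_cons
  have h' := present_layout Tile.length_ambient [] r .leftCap (x := 0) y (by decide)
  simp only [totalWidth, List.map_nil, List.sum_nil, zero_add, List.nil_append] at h'
  rw [h'] at h
  have hy := present_lt_height h
  revert h
  interval_cases y <;> decide

/-- Placements between the frozen and the ambient cells of capped words are equal as soon as they
have the same shape. -/
theorem eq_of_shape_eq {n : ℕ} {w w' : List Tile} (hw : Capped w) (hw' : Capped w')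
    {C D : Configuration n} (hC : cells (layout Tile.frozen w) ⊆ C.1)
    (hC' : C.1 ⊆ cells (layout Tile.ambient w)) (hD : cells (layout Tile.frozen w') ⊆ D.1)
    (hD' : D.1 ⊆ cells (layout Tile.ambient w')) (h : C.shape = D.shape) : C = D := by
  obtain ⟨v, hv⟩ := Configuration.shape_eq_iff.1 h
  have corner : ((0 : ℤ), (5 : ℤ)) ∈ C.1 ∧ ((0 : ℤ), (5 : ℤ)) ∈ D.1 :=
    ⟨hC (natCast_mem_cells.2 hw.present_first), hD (natCast_mem_cells.2 hw'.present_first)⟩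
  -- In each placement `(0, 5)` is the lowest cell of the leftmost column, which leaves only the
  -- zero translation.
  have bounds : ∀ {w : List Tile}, Capped w → ∀ {E : Finset Cell},
      E ⊆ cells (layout Tile.ambient w) → ∀ p ∈ E, 0 ≤ p.1 ∧ (p.1 = 0 → 5 ≤ p.2) := by
    intro w hw E hE p hp
    obtain ⟨x, y, rfl, hxy⟩ := mem_cells.1 (hE hp)
    refine ⟨by simp, fun h => ?_⟩
    obtain rfl : x = 0 := by simpa using h
    have := present_first_column hw hxy
    simpa using this
  obtain ⟨h1, h2⟩ := bounds hw' hD' _ ((hv _).1 corner.1)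
  obtain ⟨h3, h4⟩ := bounds hw hC' _ ((hv ((0, 5) - v)).2 (by simpa using corner.2))
  simp only [Prod.fst_add, Prod.snd_add, Prod.fst_sub, Prod.snd_sub] at h1 h2 h3 h4
  obtain rfl : v = 0 := Prod.ext (by simp only [Prod.fst_zero]; omega)
    (by have := h2 (by omega); have := h4 (by omega); simp only [Prod.snd_zero]; omega)
  exact Subtype.ext (Finset.ext fun p => by simpa using hv p)

/-- The configuration of a word. -/
def wordConfig {n : ℕ} (f g : List Bool) (r : ℕ)
    (hn : 86 + 13 * f.length + 67 * g.length + r = n) : Configuration n :=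
  ⟨cells (layout Tile.occupied (word f g r)), (card_word f g r).trans hn,
    (capped_word f g r).facetConnected⟩

/-- The shape of a word. -/
def wordShape {n : ℕ} (f g : List Bool) (r : ℕ)
    (hn : 86 + 13 * f.length + 67 * g.length + r = n) : Shape n := (wordConfig f g r hn).shape

section

variable {n r : ℕ} {f f' g g' : List Bool} {hn : 86 + 13 * f.length + 67 * g.length + r = n}

theorem onlyGamma_wordShape : (wordShape f g r hn).OnlyGamma :=
  ⟨wordConfig f g r hn, rfl, not_hasPatternI_cells (goodWindows_word midTiles_ne_cap),
    not_hasPatternZ_cells (goodWindows_word midTiles_ne_cap)⟩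

/-- The shapes in the component of a word. -/
theorem exists_of_reachable {M : MoveSet} {Y : Shape n}
    (h : (reconfGraph M n).Reachable (wordShape f g r hn) Y) :
    ∃ D : Configuration n, D.shape = Y ∧ cells (layout Tile.frozen (word f g r)) ⊆ D.1 ∧
      D.1 ⊆ cells (layout Tile.ambient (word f g r)) :=
  (capped_word f g r).enclosure.reachable_shapesBetween
    ⟨wordConfig f g r hn, rfl, frozen_subset_occupied _, occupied_subset_ambient _⟩ h

/-- The second word lies between the frozen and the ambient cells of the first, up to no
translation; the bumps are frozen and aligned, so they agree. -/
theorem eq_of_reachable {M : MoveSet} {hn' : 86 + 13 * f'.length + 67 * g'.length + r = n}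
    (hl : f.length = f'.length)
    (h : (reconfGraph M n).Reachable (wordShape f g r hn) (wordShape f' g' r hn')) : f = f' := by
  obtain ⟨D, hD, hFD, hDA⟩ := exists_of_reachable h
  have : D = wordConfig f' g' r hn' := eq_of_shape_eq (capped_word f g r) (capped_word f' g' r)
    hFD hDA (frozen_subset_occupied _) (occupied_subset_ambient _) hD
  rw [this] at hFD
  exact eq_of_frozen_le_ambient hl
    (ColumnsLE.of_cells_subset (hFD.trans (occupied_subset_ambient _)))

theorem eq_of_wordShape_eq {hn' : 86 + 13 * f.length + 67 * g'.length + r = n}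
    (hl : g.length = g'.length) (h : wordShape f g r hn = wordShape f g' r hn') : g = g' := by
  have h1 : wordConfig f g r hn = wordConfig f g' r hn' :=
    eq_of_shape_eq (capped_word f g r) (capped_word f g' r) (frozen_subset_occupied _)
      (occupied_subset_ambient _) (frozen_subset_occupied _) (occupied_subset_ambient _) h
  have h2 : cells (layout Tile.occupied (word f g r)) =
      cells (layout Tile.occupied (word f g' r)) := congrArg Subtype.val h1
  exact eq_of_occupied_le hl (ColumnsLE.of_cells_subset h2.subset)

theorem layout_eq_of_no_room {G : Tile → List ℕ} (hG : G = Tile.frozen ∨ G = Tile.ambient) :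
    layout G (word f [] r) = layout Tile.occupied (word f [] r) := by
  have h : ∀ t ∈ word f [] r, G t = t.occupied := by
    intro t ht
    simp only [word, midTiles, List.mem_append, List.mem_map, List.mem_replicate, List.mem_cons,
      List.not_mem_nil, List.map_nil, or_false, false_or] at ht
    rcases ht with rfl | (⟨b, -, rfl⟩ | ⟨-, rfl⟩) | rfl <;> rcases hG with rfl | rfl <;>
      first | rfl | (cases b <;> rfl)
  rw [layout, layout, List.flatMap_def, List.flatMap_def, List.map_congr_left h]

/-- A word without rooms is rigid. -/
theorem eq_wordShape_of_reachable {hn : 86 + 13 * f.length + 67 * ([] : List Bool).length + r = n}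
    {M : MoveSet} {Y : Shape n} (h : (reconfGraph M n).Reachable (wordShape f [] r hn) Y) :
    Y = wordShape f [] r hn := by
  obtain ⟨D, rfl, hFD, hDA⟩ := exists_of_reachable h
  rw [layout_eq_of_no_room (Or.inl rfl)] at hFD
  rw [layout_eq_of_no_room (Or.inr rfl)] at hDA
  have : D = wordConfig f [] r hn := Subtype.ext (hDA.antisymm hFD)
  rw [this]; rfl

end

/-! ### Words in the induced subgraph -/

/-- The reconfiguration graph induced by the configurations without patterns I and Z. -/
abbrev gammaGraph (M : MoveSet) (n : ℕ) : SimpleGraph {X : Shape n | X.OnlyGamma} :=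
  (reconfGraph M n).induce {X | X.OnlyGamma}

/-- The shape of a word, as a node of the induced graph. -/
def wordNode {n : ℕ} (f g : List Bool) (r : ℕ)
    (hn : 86 + 13 * f.length + 67 * g.length + r = n) : {X : Shape n | X.OnlyGamma} :=
  ⟨wordShape f g r hn, onlyGamma_wordShape⟩

theorem reachable_of_gammaGraph {M : MoveSet} {n : ℕ} {X Y : {X : Shape n | X.OnlyGamma}}
    (h : (gammaGraph M n).Reachable X Y) : (reconfGraph M n).Reachable X.1 Y.1 :=
  h.map (SimpleGraph.Embedding.induce _).toHom

theorem adj_wordNode (M : MoveSet) {n r : ℕ} {f : List Bool} (l s : List Bool)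
    (hn : 86 + 13 * f.length + 67 * (l ++ true :: s).length + r = n)
    (hn' : 86 + 13 * f.length + 67 * (l ++ false :: s).length + r = n) :
    (gammaGraph M n).Adj (wordNode f (l ++ true :: s) r hn) (wordNode f (l ++ false :: s) r hn') := by
  rw [SimpleGraph.induce_adj, reconfGraph, SimpleGraph.fromRel_adj]
  refine ⟨fun h => ?_, Or.inl ⟨wordConfig _ _ r hn, wordConfig _ _ r hn', rfl, rfl, ?_⟩⟩
  · have h' := eq_of_wordShape_eq (by simp) h
    simp at h'
  · have e : ∀ b, word f (l ++ b :: s) r = (.leftCap :: (f.map bump ++ l.map roomOf)) ++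
        roomOf b :: (s.map roomOf ++ List.replicate r .link ++ [.rightCap]) := by
      intro b; simp [word, midTiles]
    have hcap : Capped ((.leftCap :: (f.map bump ++ l.map roomOf)) ++
        .room :: (s.map roomOf ++ List.replicate r .link ++ [.rightCap])) := by
      have := capped_of_mid (m := f.map bump ++ (l.map roomOf ++ .room :: (s.map roomOf ++
        List.replicate r .link))) ?_
      · simpa using this
      · intro t ht
        by_cases h : t = .room
        · subst h; simp
        · refine midTiles_ne_cap (f := f) (g := l ++ s) (r := r) t ?_
          simp only [List.mem_append, List.mem_cons, h, false_or] at ht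
          simp only [midTiles, List.map_append, List.mem_append]
          tauto
    change PivotStep M (cells (layout Tile.occupied (word _ _ _)))
      (cells (layout Tile.occupied (word _ _ _)))
    rw [e, e]
    exact pivotStep_room M hcap

/-- The loose modules are brought to the right position one room at a time; `l` collects the rooms
already treated. Every intermediate node is a word, hence Γ-only. -/
theorem reachable_wordNode (M : MoveSet) {n r : ℕ} {f : List Bool} : ∀ (g l : List Bool)
    (hn : 86 + 13 * f.length + 67 * (l ++ g).length + r = n)
    (hn' : 86 + 13 * f.length + 67 * (l ++ List.replicate g.length false).length + r = n),
    (gammaGraph M n).Reachable (wordNode f (l ++ g) r hn)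
      (wordNode f (l ++ List.replicate g.length false) r hn')
  | [], l, hn, hn' => SimpleGraph.Reachable.refl _
  | b :: g, l, hn, hn' => by
    have h1 : (gammaGraph M n).Reachable (wordNode f (l ++ b :: g) r hn)
        (wordNode f (l ++ false :: g) r (by simpa using hn)) := by
      cases b
      · exact SimpleGraph.Reachable.refl _
      · exact (adj_wordNode M l g hn (by simpa using hn)).reachable
    have h2 := reachable_wordNode M (n := n) (r := r) (f := f) g (l ++ [false])
      (by simpa using hn) (by simp at hn ⊢; omega)
    refine h1.trans ?_
    simpa [List.replicate_succ] using h2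

/-! ### Counting -/

theorem two_pow_le_ncard {k : ℕ} {α : Type*} [Finite α] {S : Set α} (φ : (Fin k → Bool) → α)
    (hφ : Function.Injective φ) (hS : ∀ f, φ f ∈ S) {c : ℝ} {n : ℕ} (hc : c ^ n ≤ 2 ^ k) :
    c ^ n ≤ (S.ncard : ℝ) := by
  have h1 : (Set.range φ).ncard = 2 ^ k := by
    rw [← Set.image_univ, Set.ncard_image_of_injective _ hφ, Set.ncard_univ]
    simp
  have h2 : (Set.range φ).ncard ≤ S.ncard :=
    Set.ncard_le_ncard (Set.range_subset_iff.2 hS) (Set.toFinite S)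
  rw [h1] at h2
  exact hc.trans (by exact_mod_cast h2)

theorem exists_growth_rate (D : ℕ) (hD : 0 < D) :
    ∃ c : ℝ, 1 < c ∧ ∀ n k : ℕ, n ≤ D * k → c ^ n ≤ 2 ^ k := by
  -- The `D`-th root of two, so that `c ^ (D * k) = 2 ^ k`.
  refine ⟨(2 : ℝ) ^ ((D : ℝ)⁻¹), Real.one_lt_rpow (by norm_num) (by positivity), fun n k h => ?_⟩
  have h1 : (1 : ℝ) ≤ (2 : ℝ) ^ ((D : ℝ)⁻¹) := Real.one_le_rpow (by norm_num) (by positivity)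
  calc ((2 : ℝ) ^ ((D : ℝ)⁻¹)) ^ n ≤ ((2 : ℝ) ^ ((D : ℝ)⁻¹)) ^ (D * k) := pow_le_pow_right₀ h1 h
    _ = 2 ^ k := by rw [pow_mul, Real.rpow_inv_natCast_pow (by norm_num) hD.ne']

theorem mainTheorem3 :
    ∃ c : ℝ, 1 < c ∧ ∃ N : ℕ, ∀ M : MoveSet, ∀ n : ℕ, N ≤ n →
      -- rigid components, and components of exponential size, of the reconfiguration graph
      (c ^ n ≤ ({K : (reconfGraph M n).ConnectedComponent |
          ∃ X : Shape n, X.OnlyGamma ∧ K.supp = {X}}.ncard : ℝ) ∧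
        c ^ n ≤ ({K : (reconfGraph M n).ConnectedComponent |
          c ^ n ≤ ({X : Shape n | X ∈ K.supp ∧ X.OnlyGamma}.ncard : ℝ)}.ncard : ℝ)) ∧
      -- the same for its subgraph induced by the configurations without patterns I and Z
      (c ^ n ≤ ({K : ((reconfGraph M n).induce {X | X.OnlyGamma}).ConnectedComponent |
          K.supp.ncard = 1}.ncard : ℝ) ∧
        c ^ n ≤ ({K : ((reconfGraph M n).induce {X | X.OnlyGamma}).ConnectedComponent |
          c ^ n ≤ (K.supp.ncard : ℝ)}.ncard : ℝ)) := by
  obtain ⟨c, hc, hck⟩ := exists_growth_rate 246 (by norm_num)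
  refine ⟨c, hc, 166, fun M n hN => ?_⟩
  -- The caps have 86 cells, and a bump with a room has 13 + 67 = 80. The largest `k` with `86 + 80
  -- * k ≤ n` is positive from `n = 166` on, and then `n < 166 + 80 * k ≤ 246 * k`. The remaining
  -- cells are links.
  obtain ⟨k, r, r', hr, hr', hnk⟩ : ∃ k r r', 86 + 13 * k + 67 * 0 + r = n ∧
      86 + 13 * k + 67 * k + r' = n ∧ n ≤ 246 * k :=
    ⟨(n - 86) / 80, n - 86 - 13 * ((n - 86) / 80), n - 86 - 80 * ((n - 86) / 80),
      by omega, by omega, by omega⟩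
  have hcn : c ^ n ≤ 2 ^ k := hck n k hnk
  let rigid : (Fin k → Bool) → {X : Shape n | X.OnlyGamma} := fun f =>
    wordNode (List.ofFn f) [] r (by simpa using hr)
  let loose : (Fin k → Bool) → (Fin k → Bool) → {X : Shape n | X.OnlyGamma} := fun f g =>
    wordNode (List.ofFn f) (List.ofFn g) r' (by simpa using hr')
  have hrigid : ∀ f Y, (reconfGraph M n).Reachable (rigid f).1 Y → Y = (rigid f).1 :=
    fun f Y h => eq_wordShape_of_reachable h
  have hrigid_inj : ∀ f f', (reconfGraph M n).Reachable (rigid f).1 (rigid f').1 → f = f' :=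
    fun f f' h => List.ofFn_injective (eq_of_reachable (by simp) h)
  have hloose_inj : ∀ f f' g g', (reconfGraph M n).Reachable (loose f g).1 (loose f' g').1 →
      f = f' := fun f f' g g' h => List.ofFn_injective (eq_of_reachable (by simp) h)
  have hloose_inj' : ∀ f g g', (loose f g).1 = (loose f g').1 → g = g' :=
    fun f g g' h => List.ofFn_injective (eq_of_wordShape_eq (by simp) h)
  have hloose : ∀ f g, (gammaGraph M n).Reachable (loose f g) (loose f fun _ => false) := by
    intro f g
    have := reachable_wordNode M (n := n) (r := r') (f := List.ofFn f) (List.ofFn g) []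
      (by simpa using hr') (by simpa using hr')
    simpa [loose, List.ofFn_const] using this
  refine ⟨⟨?_, ?_⟩, ?_, ?_⟩
  · refine two_pow_le_ncard (fun f => (reconfGraph M n).connectedComponentMk (rigid f).1)
      (fun f f' h => hrigid_inj f f' (SimpleGraph.ConnectedComponent.exact h))
      (fun f => ?_) hcn
    refine ⟨(rigid f).1, (rigid f).2, ?_⟩
    ext Y
    rw [SimpleGraph.ConnectedComponent.mem_supp_iff, SimpleGraph.ConnectedComponent.eq,
      Set.mem_singleton_iff]
    exact ⟨fun h => hrigid f Y h.symm, fun h => h ▸ SimpleGraph.Reachable.refl _⟩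
  · refine two_pow_le_ncard
      (fun f => (reconfGraph M n).connectedComponentMk (loose f fun _ => false).1)
      (fun f f' h => hloose_inj f f' _ _ (SimpleGraph.ConnectedComponent.exact h))
      (fun f => ?_) hcn
    refine two_pow_le_ncard (fun g => (loose f g).1) (fun g g' h => hloose_inj' f g g' h)
      (fun g => ?_) hcn
    refine ⟨?_, (loose f g).2⟩
    rw [SimpleGraph.ConnectedComponent.mem_supp_iff, SimpleGraph.ConnectedComponent.eq]
    exact reachable_of_gammaGraph (hloose f g)
  · refine two_pow_le_ncard (fun f => (gammaGraph M n).connectedComponentMk (rigid f))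
      (fun f f' h => hrigid_inj f f'
        (reachable_of_gammaGraph (SimpleGraph.ConnectedComponent.exact h)))
      (fun f => ?_) hcn
    refine Set.ncard_eq_one.2 ⟨rigid f, ?_⟩
    ext Y
    rw [SimpleGraph.ConnectedComponent.mem_supp_iff, SimpleGraph.ConnectedComponent.eq,
      Set.mem_singleton_iff]
    exact ⟨fun h => Subtype.ext (hrigid f Y.1 (reachable_of_gammaGraph h.symm)),
      fun h => h ▸ SimpleGraph.Reachable.refl _⟩
  · refine two_pow_le_ncard (fun f => (gammaGraph M n).connectedComponentMk (loose f fun _ => false))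
      (fun f f' h => hloose_inj f f' _ _
        (reachable_of_gammaGraph (SimpleGraph.ConnectedComponent.exact h)))
      (fun f => ?_) hcn
    refine two_pow_le_ncard (fun g => loose f g)
      (fun g g' h => hloose_inj' f g g' (congrArg Subtype.val h)) (fun g => ?_) hcn
    rw [SimpleGraph.ConnectedComponent.mem_supp_iff, SimpleGraph.ConnectedComponent.eq]
    exact hloose f g
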